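/- Let $O_{A_{\mathbb N}}$ be the (non-unital) universal $C^*$-algebra generated by a sequence of partial isometries $s_0,s_1,s_2,\dots$ subject to $$s_i^*s_j=0\ \ (i\neq j),\qquad s_i^*s_i=\sum_{k=0}^{i}s_ks_k^*\ \ (i\ge 0).$$ Let $\mathcal F$ be the weakly monotone Fock space over $\mathbb N=\{1,2,\dots\}$, i.e. the Hilbert space with orthonormal basis $e_{i_1}\otimes\cdots\otimes e_{i_k}$, $k\ge 0$, $i_1\ge\cdots\ge i_k\ge 1$ (the vector with $k=0$ is the vacuum $\Omega$). Let $P_\Omega$ be the orthogonal projection onto $\mathbb C\Omega$ and, for $i\ge 1$, let $A_i^\dagger$ be the creator: $A_i^\dagger\Omega=e_i$, $A_i^\dagger(e_{i_1}\otimes\cdots\otimes e_{i_k})=e_i\otimes e_{i_1}\otimes\cdots\otimes e_{i_k}$ if $i\ge i_1$, and $=0$ otherwise. For $z\in\mathbb T$ let $\widetilde\pi_{0,z}:O_{A_{\mathbb N}}\to B(\mathcal F)$ be the representation with $\widetilde\pi_{0,z}(s_0)=zP_\Omega$ and $\widetilde\pi_{0,z}(s_i)=A_i^\dagger$ for $i\ge1$.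 For $n\ge 0$ let $J_n$ be the closed two-sided ideal of $O_{A_{\mathbb N}}$ generated by $s_0,\dots,s_{n-1}$ (so $J_0=\{0\}$) and $p_n:O_{A_{\mathbb N}}\to O_{A_{\mathbb N}}/J_n$ the quotient map. A representation is called irreducible if it is non-zero and has no closed invariant subspace other than $\{0\}$ and the whole space. Then: 1. For every $n\ge 0$ there is a unique $*$-isomorphism $\Psi_n:O_{A_{\mathbb N}}\to O_{A_{\mathbb N}}/J_n$ with $\Psi_n(s_i)=p_n(s_{i+n})$ for all $i\ge 0$. Put $\widetilde\pi_{n,z}:=\widetilde\pi_{0,z}\circ\Psi_n^{-1}\circ p_n$ (for $n=0$ this is $\widetilde\pi_{0,z}$ itself). 2. Every $\widetilde\pi_{n,z}$ ($n\ge0$, $z\in\mathbb T$) is irreducible, and every irreducible representation of $O_{A_{\mathbb N}}$ on a Hilbert space is unitarily equivalent to $\widetilde\pi_{n,z}$ for some $n\ge 0$ and some $z\in\mathbb T$. 3. Each $\widetilde\pi_{0,z}$ is irreducible with $\widetilde\pi_{0,z}(s_0)\ne0$, and an irreducible representation $\pi$ of $O_{A_{\mathbb N}}$ satisfies $\pi(s_0)\neq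 0$ if and only if it is unitarily equivalent to $\widetilde\pi_{0,z}$ for some $z\in\mathbb T$. -/

import Mathlib

noncomputable section

open Finset

namespace WM

/-! ### The free complex `*`-algebra on generators indexed by `ℕ` -/

/-- Formal expressions in the generators. -/
inductive Pre : Type
  | of : ℕ → Pre
  | zero : Pre
  | add : Pre → Pre → Pre
  | mul : Pre → Pre → Pre
  | smul : ℂ → Pre → Pre
  | star : Pre → Pre

/-- The axioms of a (non-unital, associative) complex `*`-algebra, together with congruence. -/
inductive Rel : Pre → Pre → Prop
  | add_assoc (a b c) : Rel (.add (.add a b) c) (.add a (.add b c))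
  | add_comm (a b) : Rel (.add a b) (.add b a)
  | zero_add (a) : Rel (.add .zero a) a
  | neg_add (a) : Rel (.add (.smul (-1) a) a) .zero
  | mul_assoc (a b c) : Rel (.mul (.mul a b) c) (.mul a (.mul b c))
  | mul_add (a b c) : Rel (.mul a (.add b c)) (.add (.mul a b) (.mul a c))
  | add_mul (a b c) : Rel (.mul (.add a b) c) (.add (.mul a c) (.mul b c))
  | one_smul (a) : Rel (.smul 1 a) a
  | mul_smul (r s a) : Rel (.smul (r * s) a) (.smul r (.smul s a))
  | smul_add (r a b) : Rel (.smul r (.add a b)) (.add (.smul r a) (.smul r b))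
  | add_smul (r s a) : Rel (.smul (r + s) a) (.add (.smul r a) (.smul s a))
  | smul_mul (r a b) : Rel (.mul (.smul r a) b) (.smul r (.mul a b))
  | mul_smul' (r a b) : Rel (.mul a (.smul r b)) (.smul r (.mul a b))
  | star_star (a) : Rel (.star (.star a)) a
  | star_add (a b) : Rel (.star (.add a b)) (.add (.star a) (.star b))
  | star_mul (a b) : Rel (.star (.mul a b)) (.mul (.star b) (.star a))
  | star_smul (r : ℂ) (a) : Rel (.star (.smul r a)) (.smul (Star.star r) (.star a))
  | add_left {a b} (c) : Rel a b → Rel (.add a c) (.add b c)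
  | add_right (a) {b c} : Rel b c → Rel (.add a b) (.add a c)
  | mul_left {a b} (c) : Rel a b → Rel (.mul a c) (.mul b c)
  | mul_right (a) {b c} : Rel b c → Rel (.mul a b) (.mul a c)
  | smul_congr (r) {a b} : Rel a b → Rel (.smul r a) (.smul r b)
  | star_congr {a b} : Rel a b → Rel (.star a) (.star b)

/-- The free (non-unital) complex `*`-algebra on the generators `x_0, x_1, …`. -/
def Free : Type := Quot Rel

namespace Free

/-- The generator `x_i`. -/
def gen (i : ℕ) : Free := Quot.mk _ (.of i)

instance : Zero Free := ⟨Quot.mk _ .zero⟩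
instance : Add Free :=
  ⟨Quot.map₂ .add (fun a _ _ h => .add_right a h) (fun _ _ c h => .add_left c h)⟩
instance : Mul Free :=
  ⟨Quot.map₂ .mul (fun a _ _ h => .mul_right a h) (fun _ _ c h => .mul_left c h)⟩
instance : SMul ℂ Free := ⟨fun r => Quot.map (.smul r) (fun _ _ h => .smul_congr r h)⟩
instance : Star Free := ⟨Quot.map .star (fun _ _ h => .star_congr h)⟩
instance : Neg Free := ⟨fun a => (-1 : ℂ) • a⟩

protected theorem add_comm' (a b : Free) : a + b = b + a := by
  induction a using Quot.ind; induction b using Quot.ind; exact Quot.sound (.add_comm _ _)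

protected theorem zero_add' (a : Free) : 0 + a = a := by
  induction a using Quot.ind; exact Quot.sound (.zero_add _)

instance : AddCommGroup Free where
  add_assoc a b c := by
    induction a using Quot.ind; induction b using Quot.ind; induction c using Quot.ind
    exact Quot.sound (.add_assoc _ _ _)
  zero_add := Free.zero_add'
  add_zero a := by rw [Free.add_comm', Free.zero_add']
  add_comm := Free.add_comm'
  neg_add_cancel a := by induction a using Quot.ind; exact Quot.sound (.neg_add _)
  nsmul := nsmulRec
  zsmul := zsmulRec

instance : Module ℂ Free := Module.ofMinimalAxioms
  (fun r a b => by
    induction a using Quot.ind; induction b using Quot.ind; exact Quot.sound (.smul_add _ _ _))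
  (fun r s a => by induction a using Quot.ind; exact Quot.sound (.add_smul _ _ _))
  (fun r s a => by induction a using Quot.ind; exact Quot.sound (.mul_smul _ _ _))
  (fun a => by induction a using Quot.ind; exact Quot.sound (.one_smul _))

protected theorem mul_add' (a b c : Free) : a * (b + c) = a * b + a * c := by
  induction a using Quot.ind; induction b using Quot.ind; induction c using Quot.ind
  exact Quot.sound (.mul_add _ _ _)

protected theorem add_mul' (a b c : Free) : (a + b) * c = a * c + b * c := by
  induction a using Quot.ind; induction b using Quot.ind; induction c using Quot.ind
  exact Quot.sound (.add_mul _ _ _)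

instance : NonUnitalRing Free where
  left_distrib := Free.mul_add'
  right_distrib := Free.add_mul'
  zero_mul a := by
    have h := Free.add_mul' 0 0 a
    rw [zero_add] at h
    simpa using h
  mul_zero a := by
    have h := Free.mul_add' a 0 0
    rw [zero_add] at h
    simpa using h
  mul_assoc a b c := by
    induction a using Quot.ind; induction b using Quot.ind; induction c using Quot.ind
    exact Quot.sound (.mul_assoc _ _ _)

instance : StarRing Free where
  star_involutive a := by induction a using Quot.ind; exact Quot.sound (.star_star _)
  star_mul a b := by
    induction a using Quot.ind; induction b using Quot.ind; exact Quot.sound (.star_mul _ _)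
  star_add a b := by
    induction a using Quot.ind; induction b using Quot.ind; exact Quot.sound (.star_add _ _)

instance : StarModule ℂ Free where
  star_smul r a := by induction a using Quot.ind; exact Quot.sound (.star_smul _ _)

instance : IsScalarTower ℂ Free Free where
  smul_assoc r a b := by
    induction a using Quot.ind; induction b using Quot.ind; exact Quot.sound (.smul_mul _ _ _)

instance : SMulCommClass ℂ Free Free where
  smul_comm r a b := by
    induction a using Quot.ind; induction b using Quot.ind
    exact (Quot.sound (.mul_smul' _ _ _)).symm

/-- Induction over the free `*`-algebra. -/
theorem induction {P : Free → Prop} (hgen : ∀ i, P (gen i)) (h0 : P 0)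
    (hadd : ∀ a b, P a → P b → P (a + b)) (hmul : ∀ a b, P a → P b → P (a * b))
    (hsmul : ∀ (r : ℂ) a, P a → P (r • a)) (hstar : ∀ a, P a → P (star a)) (a : Free) : P a := by
  induction a using Quot.ind with
  | mk a =>
    induction a with
    | of i => exact hgen i
    | zero => exact h0
    | add a b ha hb => exact hadd _ _ ha hb
    | mul a b ha hb => exact hmul _ _ ha hb
    | smul r a ha => exact hsmul r _ ha
    | star a ha => exact hstar _ ha

section Eval

variable {A : Type*} [NonUnitalRing A] [StarRing A] [Module ℂ A] [IsScalarTower ℂ A A]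
  [SMulCommClass ℂ A A] [StarModule ℂ A] (S : ℕ → A)

/-- Evaluation of a formal expression. -/
def evalPre : Pre → A
  | .of i => S i
  | .zero => 0
  | .add a b => evalPre a + evalPre b
  | .mul a b => evalPre a * evalPre b
  | .smul r a => r • evalPre a
  | .star a => Star.star (evalPre a)

theorem evalPre_congr {a b : Pre} (h : Rel a b) : evalPre S a = evalPre S b := by
  induction h with
  | add_assoc => exact add_assoc _ _ _
  | add_comm => exact add_comm _ _
  | zero_add => exact zero_add _
  | neg_add => simp [evalPre]
  | mul_assoc => exact mul_assoc _ _ _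
  | mul_add => exact mul_add _ _ _
  | add_mul => exact add_mul _ _ _
  | one_smul => exact one_smul _ _
  | mul_smul => exact mul_smul _ _ _
  | smul_add => exact smul_add _ _ _
  | add_smul => exact add_smul _ _ _
  | smul_mul => exact smul_mul_assoc _ _ _
  | mul_smul' => exact mul_smul_comm _ _ _
  | star_star => exact star_star _
  | star_add => exact star_add _ _
  | star_mul => exact star_mul _ _
  | star_smul => exact star_smul _ _
  | add_left _ _ ih => simp only [evalPre, ih]
  | add_right _ _ ih => simp only [evalPre, ih]
  | mul_left _ _ ih => simp only [evalPre, ih]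
  | mul_right _ _ ih => simp only [evalPre, ih]
  | smul_congr _ _ ih => simp only [evalPre, ih]
  | star_congr _ ih => simp only [evalPre, ih]

/-- The `*`-homomorphism from the free `*`-algebra determined by the images of the generators. -/
def eval : Free →⋆ₙₐ[ℂ] A where
  toFun := Quot.lift (evalPre S) fun _ _ h => evalPre_congr S h
  map_zero' := rfl
  map_smul' r a := by induction a using Quot.ind; rfl
  map_add' a b := by induction a using Quot.ind; induction b using Quot.ind; rfl
  map_mul' a b := by induction a using Quot.ind; induction b using Quot.ind; rfl
  map_star' a := by induction a using Quot.ind; rfl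

@[simp] theorem eval_gen (i : ℕ) : eval S (gen i) = S i := rfl

end Eval

end Free

/-! ### The universal C*-algebra -/

/-- A sequence of partial isometries `S 0, S 1, …` with `S i* S j = 0` for `i ≠ j` and
`S i* S i = ∑_{k ≤ i} S k S k*`. -/
structure IsWMFamily {A : Type*} [NonUnitalRing A] [StarRing A] (S : ℕ → A) : Prop where
  partialIsometry : ∀ i, S i * star (S i) * S i = S i
  orthogonal : ∀ i j, i ≠ j → star (S i) * S j = 0
  support : ∀ i, star (S i) * S i = ∑ k ∈ range (i + 1), S k * star (S k)

/-- The C*-seminorms on the free `*`-algebra for which the generators satisfy the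
relations `IsWMFamily`. -/
structure CSeminorm where
  toSeminorm : Seminorm ℂ Free
  mul_le : ∀ a b, toSeminorm (a * b) ≤ toSeminorm a * toSeminorm b
  star_mul_self : ∀ a, toSeminorm (star a * a) = toSeminorm a ^ 2
  partialIsometry : ∀ i, toSeminorm (.gen i * star (.gen i) * .gen i - .gen i) = 0
  orthogonal : ∀ i j, i ≠ j → toSeminorm (star (.gen i) * .gen j) = 0
  support : ∀ i,
    toSeminorm (star (.gen i) * .gen i - ∑ k ∈ range (i + 1), .gen k * star (.gen k)) = 0

namespace CSeminorm

instance : CoeFun CSeminorm fun _ => Free → ℝ := ⟨fun p => p.toSeminorm⟩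

instance : Inhabited CSeminorm :=
  ⟨{ toSeminorm := 0
     mul_le := fun _ _ => by simp
     star_mul_self := fun _ => by simp
     partialIsometry := fun _ => rfl
     orthogonal := fun _ _ _ => rfl
     support := fun _ => rfl }⟩

variable (p : CSeminorm)

theorem mul_le' (a b : Free) : p (a * b) ≤ p a * p b := p.mul_le a b

theorem star_mul_self' (a : Free) : p (star a * a) = p a ^ 2 := p.star_mul_self a

theorem le_star (a : Free) : p a ≤ p (star a) := by
  rcases (apply_nonneg p.toSeminorm a).eq_or_lt with h | h
  · rw [← h]; exact apply_nonneg p.toSeminorm _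
  · have h1 := p.mul_le' (star a) a
    rw [p.star_mul_self', sq] at h1
    exact le_of_mul_le_mul_right h1 h

theorem star_eq (a : Free) : p (star a) = p a :=
  le_antisymm (by simpa using p.le_star (star a)) (p.le_star a)

theorem gen_le (i : ℕ) : p (.gen i) ≤ 1 := by
  have hs : p (star (.gen i) * .gen i * (star (.gen i) * .gen i)) ≤ p (star (.gen i) * .gen i) := by
    have h2 : p (star (.gen i) * (.gen i * star (.gen i) * .gen i - .gen i)) = 0 := by
      refine le_antisymm ((p.mul_le' _ _).trans ?_) (apply_nonneg p.toSeminorm _)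
      have h : p (.gen i * star (.gen i) * .gen i - .gen i) = 0 := p.partialIsometry i
      rw [h, mul_zero]
    have h3 := map_add_le_add p.toSeminorm
      (star (.gen i) * (.gen i * star (.gen i) * .gen i - .gen i)) (star (.gen i) * .gen i)
    rw [mul_sub, sub_add_cancel] at h3
    rw [mul_sub] at h2
    simp only [mul_assoc] at h2 h3 ⊢
    linarith
  have hq := p.star_mul_self' (star (.gen i) * .gen i)
  rw [star_mul, star_star] at hq
  rw [hq, p.star_mul_self'] at hs
  by_contra! hlt
  have h1 : 1 < p (.gen i) ^ 2 := by nlinarith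
  nlinarith [pow_pos (zero_lt_one.trans hlt) 2, mul_pos (sub_pos.2 hlt) (zero_lt_one.trans hlt)]

theorem bddAbove (a : Free) : ∃ C : ℝ, ∀ p : CSeminorm, p a ≤ C := by
  induction a using Free.induction with
  | hgen i => exact ⟨1, fun p => p.gen_le i⟩
  | h0 => exact ⟨0, fun p => (map_zero p.toSeminorm).le⟩
  | hadd a b ha hb =>
    obtain ⟨C, hC⟩ := ha
    obtain ⟨D, hD⟩ := hb
    exact ⟨C + D, fun p => (map_add_le_add p.toSeminorm a b).trans (add_le_add (hC p) (hD p))⟩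
  | hmul a b ha hb =>
    obtain ⟨C, hC⟩ := ha
    obtain ⟨D, hD⟩ := hb
    refine ⟨C * D, fun p => (p.mul_le' a b).trans ?_⟩
    exact mul_le_mul (hC p) (hD p) (apply_nonneg p.toSeminorm _)
      ((apply_nonneg p.toSeminorm _).trans (hC p))
  | hsmul r a ha =>
    obtain ⟨C, hC⟩ := ha
    refine ⟨‖r‖ * C, fun p => ?_⟩
    rw [map_smul_eq_mul]
    exact mul_le_mul_of_nonneg_left (hC p) (norm_nonneg _)
  | hstar a ha =>
    obtain ⟨C, hC⟩ := ha
    exact ⟨C, fun p => by rw [p.star_eq]; exact hC p⟩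

end CSeminorm

/-- The maximal C*-seminorm compatible with the relations. -/
def maxNorm (a : Free) : ℝ := ⨆ p : CSeminorm, p a

theorem le_maxNorm (p : CSeminorm) (a : Free) : p a ≤ maxNorm a := by
  obtain ⟨C, hC⟩ := CSeminorm.bddAbove a
  exact le_ciSup (f := fun p : CSeminorm => p a) ⟨C, by rintro _ ⟨q, rfl⟩; exact hC q⟩ p

theorem maxNorm_le {a : Free} {C : ℝ} (h : ∀ p : CSeminorm, p a ≤ C) : maxNorm a ≤ C :=
  ciSup_le h

theorem maxNorm_nonneg (a : Free) : 0 ≤ maxNorm a :=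
  (apply_nonneg (default : CSeminorm).toSeminorm a).trans (le_maxNorm default a)

/-- `maxNorm` as a seminorm. -/
def maxSeminorm : Seminorm ℂ Free := Seminorm.of maxNorm
  (fun a b => maxNorm_le fun p => (map_add_le_add p.toSeminorm a b).trans
    (add_le_add (le_maxNorm p a) (le_maxNorm p b)))
  (fun r a => by
    refine le_antisymm (maxNorm_le fun p => ?_) ?_
    · rw [map_smul_eq_mul]
      exact mul_le_mul_of_nonneg_left (le_maxNorm p a) (norm_nonneg _)
    · unfold maxNorm
      rw [Real.mul_iSup_of_nonneg (norm_nonneg _)]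
      refine ciSup_le fun p => ?_
      rw [← map_smul_eq_mul p.toSeminorm]
      exact le_maxNorm p _)

instance : SeminormedAddCommGroup Free := maxSeminorm.toAddGroupSeminorm.toSeminormedAddCommGroup

theorem norm_def (a : Free) : ‖a‖ = maxNorm a := rfl

instance : NormedSpace ℂ Free where
  norm_smul_le r a := (map_smul_eq_mul maxSeminorm r a).le

theorem norm_mul_le' (a b : Free) : ‖a * b‖ ≤ ‖a‖ * ‖b‖ :=
  maxNorm_le fun p => (p.mul_le' a b).trans
    (mul_le_mul (le_maxNorm p a) (le_maxNorm p b) (apply_nonneg p.toSeminorm _) (maxNorm_nonneg a))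

instance : NonUnitalSeminormedRing Free where
  dist_eq := dist_eq_norm_neg_add
  norm_mul_le := norm_mul_le'

theorem norm_star' (a : Free) : ‖star a‖ = ‖a‖ :=
  iSup_congr fun p => p.star_eq a

theorem norm_mul_self_le' (a : Free) : ‖a‖ * ‖a‖ ≤ ‖star a * a‖ := by
  have h : ‖a‖ ≤ √‖star a * a‖ := maxNorm_le fun p => Real.le_sqrt_of_sq_le (by
    rw [← p.star_mul_self']; exact le_maxNorm p _)
  calc ‖a‖ * ‖a‖ ≤ √‖star a * a‖ * √‖star a * a‖ :=
        mul_self_le_mul_self (norm_nonneg _) h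
    _ = _ := Real.mul_self_sqrt (norm_nonneg _)

open UniformSpace in
/-- The universal C*-algebra `O_{A_ℕ}`: the (Hausdorff) completion of the free `*`-algebra in the
maximal C*-seminorm compatible with the relations. -/
def OA : Type := Completion Free

namespace OA

open UniformSpace Completion

instance : NormedAddCommGroup OA := inferInstanceAs (NormedAddCommGroup (Completion Free))
instance : NormedSpace ℂ OA := inferInstanceAs (NormedSpace ℂ (Completion Free))
instance : CompleteSpace OA := inferInstanceAs (CompleteSpace (Completion Free))

/-- The canonical map from the free `*`-algebra. -/
def coe (a : Free) : OA := ((a : Completion Free) :)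

theorem denseRange_coe : DenseRange coe := Completion.denseRange_coe
theorem continuous_coe : Continuous coe := Completion.continuous_coe Free
theorem isDenseInducing_coe : IsDenseInducing coe := Completion.isDenseInducing_coe
theorem norm_coe (a : Free) : ‖coe a‖ = ‖a‖ := Completion.norm_coe a
theorem coe_zero : coe 0 = 0 := rfl
theorem coe_add (a b : Free) : coe (a + b) = coe a + coe b := Completion.coe_add a b
theorem coe_smul (r : ℂ) (a : Free) : coe (r • a) = r • coe a := Completion.coe_smul r a

@[elab_as_elim]
theorem ind {p : OA → Prop} (x : OA) (hp : IsClosed {x | p x}) (h : ∀ a, p (coe a)) : p x :=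
  Completion.induction_on x hp h

@[elab_as_elim]
theorem ind₂ {p : OA → OA → Prop} (x y : OA) (hp : IsClosed {x : OA × OA | p x.1 x.2})
    (h : ∀ a b, p (coe a) (coe b)) : p x y :=
  Completion.induction_on₂ x y hp h

@[elab_as_elim]
theorem ind₃ {p : OA → OA → OA → Prop} (x y z : OA)
    (hp : IsClosed {x : OA × OA × OA | p x.1 x.2.1 x.2.2})
    (h : ∀ a b c, p (coe a) (coe b) (coe c)) : p x y z :=
  Completion.induction_on₃ x y z hp h

instance : Mul OA :=
  ⟨fun x y => (isDenseInducing_coe.prodMap isDenseInducing_coe).extend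
    (fun q : Free × Free => coe (q.1 * q.2)) (x, y)⟩

theorem coe_mul (a b : Free) : coe (a * b) = coe a * coe b :=
  ((isDenseInducing_coe.prodMap isDenseInducing_coe).extend_eq
    (f := fun q : Free × Free => coe (q.1 * q.2))
    (continuous_coe.comp continuous_mul) (a, b)).symm

instance : ContinuousMul OA where
  continuous_mul := by
    let c : Free →+ OA := ⟨⟨coe, coe_zero⟩, coe_add⟩
    let m := (AddMonoidHom.mul : Free →+ Free →+ Free).compr₂ c
    have hm : Continuous fun p : Free × Free => m p.1 p.2 := continuous_coe.comp continuous_mul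
    have di : IsDenseInducing (c : Free → OA) := isDenseInducing_coe
    exact (di.extend_Z_bilin di hm :)

instance : Star OA := ⟨Completion.map (star : Free → Free)⟩

theorem uniformContinuous_star : UniformContinuous (star : Free → Free) := by
  refine Metric.uniformContinuous_iff.2 fun ε hε => ⟨ε, hε, fun {a b} h => ?_⟩
  rwa [dist_eq_norm, ← star_sub, norm_star', ← dist_eq_norm]

theorem coe_star (a : Free) : coe (star a) = star (coe a) :=
  (Completion.map_coe uniformContinuous_star a).symm

instance : ContinuousStar OA := ⟨Completion.continuous_map⟩

instance : NonUnitalNormedRing OA where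
  __ := (inferInstance : NormedAddCommGroup OA)
  left_distrib x y z := by
    refine ind₃ x y z (isClosed_eq (by fun_prop) (by fun_prop)) fun a b c => ?_
    rw [← coe_add, ← coe_mul, ← coe_mul, ← coe_mul, ← coe_add, mul_add]
  right_distrib x y z := by
    refine ind₃ x y z (isClosed_eq (by fun_prop) (by fun_prop)) fun a b c => ?_
    rw [← coe_add, ← coe_mul, ← coe_mul, ← coe_mul, ← coe_add, add_mul]
  zero_mul x := by
    refine ind x (isClosed_eq (by fun_prop) (by fun_prop)) fun a => ?_
    rw [← coe_zero, ← coe_mul, zero_mul]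
  mul_zero x := by
    refine ind x (isClosed_eq (by fun_prop) (by fun_prop)) fun a => ?_
    rw [← coe_zero, ← coe_mul, mul_zero]
  mul_assoc x y z := by
    refine ind₃ x y z (isClosed_eq (by fun_prop) (by fun_prop)) fun a b c => ?_
    rw [← coe_mul, ← coe_mul, ← coe_mul, ← coe_mul, mul_assoc]
  norm_mul_le x y := by
    refine ind₂ x y (isClosed_le (by fun_prop) (by fun_prop)) fun a b => ?_
    rw [← coe_mul, norm_coe, norm_coe, norm_coe]
    exact norm_mul_le' a b

instance : StarRing OA where
  star_involutive x := by
    refine ind x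
      (isClosed_eq (by fun_prop) (by fun_prop)) fun a => ?_
    rw [← coe_star, ← coe_star, star_star]
  star_mul x y := by
    refine ind₂ x y (isClosed_eq (by fun_prop) (by fun_prop)) fun a b => ?_
    rw [← coe_mul, ← coe_star, ← coe_star, ← coe_star, ← coe_mul, star_mul]
  star_add x y := by
    refine ind₂ x y (isClosed_eq (by fun_prop) (by fun_prop)) fun a b => ?_
    rw [← coe_add, ← coe_star, ← coe_star, ← coe_star, ← coe_add, star_add]

theorem continuous_smul' (r : ℂ) : Continuous fun x : OA => r • x :=
  (lipschitzWith_smul r).continuous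

theorem coe_smul_mul (r : ℂ) (a b : Free) : r • coe a * coe b = r • (coe a * coe b) := by
  rw [← coe_smul, ← coe_mul, ← coe_mul, ← coe_smul, smul_mul_assoc]

theorem coe_mul_smul (r : ℂ) (a b : Free) : r • (coe a * coe b) = coe a * r • coe b := by
  rw [← coe_smul, ← coe_mul, ← coe_mul, ← coe_smul, mul_smul_comm]

instance : NonUnitalCStarAlgebra OA where
  norm_mul_self_le x := by
    refine ind x (isClosed_le (by fun_prop) (by fun_prop)) fun a => ?_
    rw [← coe_star, ← coe_mul, norm_coe, norm_coe]
    exact norm_mul_self_le' a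
  smul_assoc r x y := ind₂ x y
    (isClosed_eq (((continuous_smul' r).comp continuous_fst).mul continuous_snd)
      ((continuous_smul' r).comp (continuous_fst.mul continuous_snd)))
    (coe_smul_mul r)
  smul_comm r x y := ind₂ x y
    (isClosed_eq ((continuous_smul' r).comp (continuous_fst.mul continuous_snd))
      (continuous_fst.mul ((continuous_smul' r).comp continuous_snd)))
    (coe_mul_smul r)
  star_smul r x := by
    refine ind x (isClosed_eq (continuous_star.comp (continuous_smul' r))
      ((continuous_smul' _).comp continuous_star)) fun a => ?_
    rw [← coe_smul, ← coe_star, ← coe_star, ← coe_smul, star_smul]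

/-- The canonical generators `s_0, s_1, …`. -/
def s (i : ℕ) : OA := coe (.gen i)

/-- `coe` as a `*`-homomorphism. -/
def coeHom : Free →⋆ₙₐ[ℂ] OA where
  toFun := coe
  map_zero' := coe_zero
  map_smul' := coe_smul
  map_add' := coe_add
  map_mul' := coe_mul
  map_star' := coe_star

theorem coe_eq_zero {a : Free} (h : ∀ p : CSeminorm, p a = 0) : coe a = 0 := by
  rw [← norm_eq_zero, norm_coe, norm_def]
  exact le_antisymm (maxNorm_le fun p => (h p).le) (maxNorm_nonneg a)

theorem isWMFamily_s : IsWMFamily s where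
  partialIsometry i := by
    have h : coeHom _ = 0 := coe_eq_zero fun p => p.partialIsometry i
    rw [map_sub, map_mul, map_mul, map_star, sub_eq_zero] at h
    exact h
  orthogonal i j hij := by
    have h : coeHom _ = 0 := coe_eq_zero fun p => p.orthogonal i j hij
    rw [map_mul, map_star] at h
    exact h
  support i := by
    have h : coeHom _ = 0 := coe_eq_zero fun p => p.support i
    rw [map_sub, map_sum, map_mul, map_star, sub_eq_zero] at h
    simp only [map_mul, map_star] at h
    exact h

section Lift

variable {A : Type*} [NonUnitalCStarAlgebra A] {S : ℕ → A}

theorem eval_seminorm (a : Free) :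
    (normSeminorm ℂ A).comp (Free.eval S : Free →ₗ[ℂ] A) a = ‖Free.eval S a‖ := rfl

/-- The C*-seminorm obtained from a family in a C*-algebra satisfying the relations. -/
def pullback (hS : IsWMFamily S) : CSeminorm where
  toSeminorm := (normSeminorm ℂ A).comp (Free.eval S : Free →ₗ[ℂ] A)
  mul_le a b := by
    change ‖Free.eval S (a * b)‖ ≤ ‖Free.eval S a‖ * ‖Free.eval S b‖
    rw [map_mul]; exact norm_mul_le _ _
  star_mul_self a := by
    change ‖Free.eval S (star a * a)‖ = ‖Free.eval S a‖ ^ 2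
    rw [map_mul, map_star, CStarRing.norm_star_mul_self, sq]
  partialIsometry i := by
    rw [eval_seminorm, norm_eq_zero, map_sub, sub_eq_zero]
    simpa only [map_mul, map_star, Free.eval_gen] using hS.partialIsometry i
  orthogonal i j hij := by
    rw [eval_seminorm, norm_eq_zero]
    simpa only [map_mul, map_star, Free.eval_gen] using hS.orthogonal i j hij
  support i := by
    rw [eval_seminorm, norm_eq_zero, map_sub, sub_eq_zero]
    simpa only [map_sum, map_mul, map_star, Free.eval_gen] using hS.support i

theorem uniformContinuous_eval (hS : IsWMFamily S) : UniformContinuous (Free.eval S) := by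
  refine Metric.uniformContinuous_iff.2 fun ε hε => ⟨ε, hε, fun {a b} h => ?_⟩
  rw [dist_eq_norm] at h ⊢
  rw [← map_sub]
  exact (le_maxNorm (pullback hS) (a - b)).trans_lt h

/-- The underlying function of `lift`. -/
def liftFun (_hS : IsWMFamily S) : OA → A := Completion.extension (Free.eval S)

theorem liftFun_coe (hS : IsWMFamily S) (a : Free) : liftFun hS (coe a) = Free.eval S a :=
  Completion.extension_coe (uniformContinuous_eval hS) a

theorem continuous_liftFun (hS : IsWMFamily S) : Continuous (liftFun hS) := Completion.continuous_extension

/-- The universal property: a family in a C*-algebra which satisfies the relations extends to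
a `*`-homomorphism. -/
def lift (hS : IsWMFamily S) : OA →⋆ₙₐ[ℂ] A where
  toFun := liftFun hS
  map_zero' := by rw [← coe_zero, liftFun_coe, map_zero]
  map_smul' r x := by
    refine ind x (isClosed_eq ((continuous_liftFun hS).comp (continuous_smul' r))
      ((continuous_liftFun hS).const_smul r)) fun a => ?_
    rw [← coe_smul, liftFun_coe, liftFun_coe, map_smul]; rfl
  map_add' x y := by
    have := continuous_liftFun hS
    refine ind₂ x y (isClosed_eq (by fun_prop) (by fun_prop)) fun a b => ?_
    rw [← coe_add, liftFun_coe, liftFun_coe, liftFun_coe, map_add]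
  map_mul' x y := by
    have := continuous_liftFun hS
    refine ind₂ x y (isClosed_eq (by fun_prop) (by fun_prop)) fun a b => ?_
    rw [← coe_mul, liftFun_coe, liftFun_coe, liftFun_coe, map_mul]
  map_star' x := by
    have := continuous_liftFun hS
    refine ind x (isClosed_eq (by fun_prop) (by fun_prop)) fun a => ?_
    rw [← coe_star, liftFun_coe, liftFun_coe, map_star]

theorem lift_s (hS : IsWMFamily S) (i : ℕ) : lift hS (s i) = S i := liftFun_coe hS (.gen i)

end Lift

end OA

/-! ### Ideals and quotients -/

/-- The closed two-sided ideal of a C*-algebra generated by a set. -/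
def closedIdeal {A : Type*} [NonUnitalCStarAlgebra A] (T : Set A) : Submodule ℂ A :=
  sInf {J | IsClosed (J : Set A) ∧ (∀ a x, x ∈ J → a * x ∈ J ∧ x * a ∈ J) ∧ T ⊆ J}

/-- `J_n`, the closed two-sided ideal generated by `s_0, …, s_{n-1}`. -/
def idealJ (n : ℕ) : Submodule ℂ OA := closedIdeal {x | ∃ i < n, x = OA.s i}

theorem closedIdeal_mul {A : Type*} [NonUnitalCStarAlgebra A] {T : Set A} (a : A) {x : A}
    (hx : x ∈ closedIdeal T) : a * x ∈ closedIdeal T ∧ x * a ∈ closedIdeal T := by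
  simp only [closedIdeal, Submodule.mem_sInf] at hx ⊢
  exact ⟨fun I hI => (hI.2.1 a x (hx I hI)).1, fun I hI => (hI.2.1 a x (hx I hI)).2⟩

theorem idealJ_mul_left {n : ℕ} (a : OA) {x : OA} (hx : x ∈ idealJ n) : a * x ∈ idealJ n :=
  (closedIdeal_mul a hx).1

theorem idealJ_mul_right {n : ℕ} (a : OA) {x : OA} (hx : x ∈ idealJ n) : x * a ∈ idealJ n :=
  (closedIdeal_mul a hx).2

theorem idealJ_star {n : ℕ} {x : OA} (hx : x ∈ idealJ n) : star x ∈ idealJ n := by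
  simp only [idealJ, closedIdeal, Submodule.mem_sInf] at hx ⊢
  rintro I ⟨hc, hm, hT⟩
  let I' : Submodule ℂ OA :=
    { carrier := {y | star y ∈ I}
      add_mem' := fun {a b} ha hb => by
        simp only [Set.mem_ofPred_eq, star_add] at *; exact I.add_mem ha hb
      zero_mem' := by simp
      smul_mem' := fun r a ha => by
        simp only [Set.mem_ofPred_eq, star_smul] at *; exact I.smul_mem _ ha }
  refine hx I' ⟨hc.preimage continuous_star, fun a y hy => ⟨?_, ?_⟩, ?_⟩
  · change star (a * y) ∈ I
    rw [star_mul]; exact (hm _ _ hy).2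
  · change star (y * a) ∈ I
    rw [star_mul]; exact (hm _ _ hy).1
  · rintro _ ⟨i, hi, rfl⟩
    change star (OA.s i) ∈ I
    rw [← OA.isWMFamily_s.partialIsometry i, star_mul, star_mul, star_star]
    rw [← mul_assoc]
    exact (hm _ _ (hm _ _ (hT ⟨i, hi, rfl⟩)).1).2

/-- The quotient `O_{A_ℕ} / J_n`. -/
abbrev Q (n : ℕ) : Type := OA ⧸ idealJ n

namespace Q

variable {n : ℕ}

instance : Mul (Q n) :=
  ⟨Quotient.map₂ (· * ·) fun a b hab c d hcd => by
    have hab' : a - b ∈ idealJ n := (Submodule.quotientRel_def _).1 hab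
    have hcd' : c - d ∈ idealJ n := (Submodule.quotientRel_def _).1 hcd
    refine (Submodule.quotientRel_def _).2 ?_
    have h : a * c - b * d = (a - b) * c + b * (c - d) := by rw [sub_mul, mul_sub]; abel
    rw [h]
    exact (idealJ n).add_mem (idealJ_mul_right _ hab') (idealJ_mul_left _ hcd')⟩

instance : Star (Q n) :=
  ⟨Quotient.map star fun a b hab => by
    have hab' : a - b ∈ idealJ n := (Submodule.quotientRel_def _).1 hab
    refine (Submodule.quotientRel_def _).2 ?_
    rw [← star_sub]
    exact idealJ_star hab'⟩

theorem mk_mul (a b : OA) : (Submodule.Quotient.mk (a * b) : Q n) =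
    Submodule.Quotient.mk a * Submodule.Quotient.mk b := rfl

theorem mk_star (a : OA) : (Submodule.Quotient.mk (star a) : Q n) =
    star (Submodule.Quotient.mk a) := rfl

instance : NonUnitalRing (Q n) where
  __ := (inferInstance : AddCommGroup (Q n))
  left_distrib := by
    rintro ⟨a⟩ ⟨b⟩ ⟨c⟩; exact congrArg Submodule.Quotient.mk (mul_add a b c)
  right_distrib := by
    rintro ⟨a⟩ ⟨b⟩ ⟨c⟩; exact congrArg Submodule.Quotient.mk (add_mul a b c)
  zero_mul := by rintro ⟨a⟩; exact congrArg Submodule.Quotient.mk (zero_mul a)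
  mul_zero := by rintro ⟨a⟩; exact congrArg Submodule.Quotient.mk (mul_zero a)
  mul_assoc := by
    rintro ⟨a⟩ ⟨b⟩ ⟨c⟩; exact congrArg Submodule.Quotient.mk (mul_assoc a b c)

instance : StarRing (Q n) where
  star_involutive := by rintro ⟨a⟩; exact congrArg Submodule.Quotient.mk (star_star a)
  star_mul := by rintro ⟨a⟩ ⟨b⟩; exact congrArg Submodule.Quotient.mk (star_mul a b)
  star_add := by rintro ⟨a⟩ ⟨b⟩; exact congrArg Submodule.Quotient.mk (star_add a b)

instance : StarModule ℂ (Q n) where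
  star_smul r := by rintro ⟨a⟩; exact congrArg Submodule.Quotient.mk (star_smul r a)

instance : IsScalarTower ℂ (Q n) (Q n) where
  smul_assoc r := by
    rintro ⟨a⟩ ⟨b⟩; exact congrArg Submodule.Quotient.mk (smul_mul_assoc r a b)

instance : SMulCommClass ℂ (Q n) (Q n) where
  smul_comm r := by
    rintro ⟨a⟩ ⟨b⟩; exact congrArg Submodule.Quotient.mk (mul_smul_comm r a b).symm

end Q

/-- The canonical projection `p_n : O_{A_ℕ} → O_{A_ℕ} / J_n`. -/
def proj (n : ℕ) : OA →⋆ₙₐ[ℂ] Q n where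
  toFun := Submodule.Quotient.mk
  map_zero' := rfl
  map_smul' _ _ := rfl
  map_add' _ _ := rfl
  map_mul' := Q.mk_mul
  map_star' := Q.mk_star

/-! ### The weakly monotone Fock space over `ℕ` -/

/-- The tuples `i_1 ≥ i_2 ≥ ⋯ ≥ i_k ≥ 1`, `k ≥ 0`. -/
@[ext]
structure Tup where
  val : List ℕ
  sorted : val.Pairwise (· ≥ ·)
  pos : ∀ j ∈ val, 1 ≤ j

namespace Tup

/-- The empty tuple. -/
def nil : Tup := ⟨[], by simp, by simp⟩

/-- The first entry of a tuple (`0` for the empty tuple). -/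
def head (γ : Tup) : ℕ := γ.val.headD 0

/-- `(i_1, …, i_k) ↦ (i, i_1, …, i_k)` for `i ≥ 1`, defined if `i ≥ i_1` or `k = 0`. -/
def push (i : ℕ) (γ : Tup) : Option Tup :=
  if h : 1 ≤ i ∧ γ.head ≤ i then
    some
      { val := i :: γ.val
        sorted := by
          obtain ⟨l, hs, hp⟩ := γ
          refine List.pairwise_cons.2 ⟨fun j hj => ?_, hs⟩
          cases l with
          | nil => cases hj
          | cons a l =>
            have ha : a ≤ i := h.2
            rcases List.mem_cons.1 hj with rfl | hj
            · exact ha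
            · exact le_trans ((List.pairwise_cons.1 hs).1 j hj) ha
        pos := by
          intro j hj
          rcases List.mem_cons.1 hj with rfl | hj
          · exact h.1
          · exact γ.pos j hj }
  else none

/-- `(i, i_2, …, i_k) ↦ (i_2, …, i_k)`, defined if the first entry is `i`. -/
def pop (i : ℕ) : Tup → Option Tup
  | ⟨[], _, _⟩ => none
  | ⟨a :: l, hs, hp⟩ => if a = i then
      some ⟨l, (List.pairwise_cons.1 hs).2, fun j hj => hp j (List.mem_cons_of_mem _ hj)⟩
    else none

theorem push_isSome {i : ℕ} {γ : Tup} : (push i γ).isSome ↔ 1 ≤ i ∧ γ.head ≤ i := by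
  unfold push
  split_ifs with h <;> simp [h]

theorem push_eq_some {i : ℕ} {γ δ : Tup} : push i γ = some δ ↔ δ.val = i :: γ.val := by
  unfold push
  split_ifs with h
  · rw [Option.some.injEq]
    exact ⟨fun e => by rw [← e], fun e => Tup.ext e.symm⟩
  · refine ⟨fun e => (by cases e), fun e => (h ?_).elim⟩
    have h1 := δ.sorted
    have h2 := δ.pos
    rw [e] at h1 h2
    refine ⟨h2 i (by simp), ?_⟩
    obtain ⟨l, hs, hp⟩ := γ
    cases l with
    | nil => exact Nat.zero_le _
    | cons a l => exact (List.pairwise_cons.1 h1).1 a (by simp)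

theorem pop_eq_some {i : ℕ} {γ δ : Tup} : pop i γ = some δ ↔ γ.val = i :: δ.val := by
  obtain ⟨l, hs, hp⟩ := γ
  cases l with
  | nil => simp [pop]
  | cons a l =>
    simp only [pop]
    split_ifs with hi
    · rw [Option.some.injEq]
      subst hi
      exact ⟨fun e => by rw [← e], fun e => Tup.ext (List.cons.inj e).2⟩
    · exact ⟨fun e => (by cases e), fun e => (hi (List.cons.inj e).1).elim⟩

theorem pop_isSome {i : ℕ} {γ : Tup} (hi : 1 ≤ i) : (pop i γ).isSome ↔ γ.head = i := by
  obtain ⟨l, hs, hp⟩ := γ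
  cases l with
  | nil => simp only [pop, head, List.headD_nil, Option.isSome_none, Bool.false_eq_true, false_iff]
           omega
  | cons a l =>
    simp only [pop, head, List.headD_cons]
    split_ifs with h <;> simp [h]

theorem head_eq_zero {γ : Tup} : γ.head = 0 ↔ γ = nil := by
  obtain ⟨l, hs, hp⟩ := γ
  cases l with
  | nil => exact ⟨fun _ => rfl, fun _ => rfl⟩
  | cons a l =>
    constructor
    · intro h0
      have := hp a (by simp)
      change a = 0 at h0
      omega
    · intro h0
      have := congrArg Tup.val h0
      simp [Tup.nil] at this

/-- `push i` as a partial bijection with partial inverse `pop i`. -/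
def pushEquiv (i : ℕ) : Tup ≃. Tup where
  toFun := push i
  invFun := pop i
  inv γ δ := by
    exact pop_eq_some.trans push_eq_some.symm

end Tup

/-- The weakly monotone Fock space: the Hilbert space with orthonormal basis
`e_γ = e_{i_1} ⊗ ⋯ ⊗ e_{i_k}`, `γ = (i_1 ≥ ⋯ ≥ i_k ≥ 1)`, including the vacuum `Ω = e_∅`. -/
abbrev Fock : Type := lp (fun _ : Tup => ℂ) 2

namespace Fock

open Classical in
/-- The basis vector `e_γ`. -/
def e (γ : Tup) : Fock := lp.single 2 γ 1

/-- The vacuum vector `Ω`. -/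
def vacuum : Fock := e Tup.nil

/-- Coefficients of the image of `f` under the operator `e_γ ↦ e_{φ γ}`
(`e_γ ↦ 0` if `φ γ` is undefined). -/
def shiftFun (φ : Tup ≃. Tup) (f : Tup → ℂ) (γ : Tup) : ℂ := (φ.symm γ).elim 0 f

theorem sum_shiftFun_le (φ : Tup ≃. Tup) (f : Fock) (t : Finset Tup) :
    ∑ γ ∈ t, ‖shiftFun φ f γ‖ ^ (2 : ENNReal).toReal ≤ ‖f‖ ^ (2 : ENNReal).toReal := by
  classical
  have h0 : ∑ γ ∈ t, ‖shiftFun φ f γ‖ ^ (2 : ENNReal).toReal =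
      ∑ δ ∈ t.filterMap φ.symm (fun a a' b h h' => PEquiv.inj φ.symm h h'),
        ‖f δ‖ ^ (2 : ENNReal).toReal := by
    induction t using Finset.induction_on with
    | empty => simp
    | insert a t ha ih =>
      rw [Finset.sum_insert ha, ih]
      cases hs : φ.symm a with
      | none =>
        have : (insert a t).filterMap φ.symm (fun a a' b h h' => PEquiv.inj φ.symm h h') =
            t.filterMap φ.symm (fun a a' b h h' => PEquiv.inj φ.symm h h') := by
          ext b; simp [hs]
        rw [this]
        simp [shiftFun, hs]
      | some b =>
        have : (insert a t).filterMap φ.symm (fun a a' b h h' => PEquiv.inj φ.symm h h') =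
            insert b (t.filterMap φ.symm (fun a a' b h h' => PEquiv.inj φ.symm h h')) := by
          ext c; simp [hs, eq_comm]
        rw [this, Finset.sum_insert]
        · simp [shiftFun, hs]
        · simp only [Finset.mem_filterMap, not_exists, not_and]
          intro a' ha' h'
          exact ha (PEquiv.inj φ.symm (b := b) hs h' ▸ ha')
  rw [h0]
  exact lp.sum_rpow_le_norm_rpow (by norm_num) f _

/-- The operator `e_γ ↦ e_{φ γ}` (and `e_γ ↦ 0` if `φ γ` is undefined) of a partial bijection. -/
def shiftOp (φ : Tup ≃. Tup) : Fock →L[ℂ] Fock :=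
  LinearMap.mkContinuous
    { toFun := fun f => ⟨shiftFun φ f, memℓp_gen' (sum_shiftFun_le φ f)⟩
      map_add' := fun f g => by
        ext γ
        change shiftFun φ (f + g : Fock) γ = shiftFun φ f γ + shiftFun φ g γ
        unfold shiftFun
        cases φ.symm γ with
        | none => exact (add_zero (0 : ℂ)).symm
        | some b => rfl
      map_smul' := fun r f => by
        ext γ
        change shiftFun φ (r • f : Fock) γ = r • shiftFun φ f γ
        unfold shiftFun
        cases φ.symm γ with
        | none => simp
        | some b => rfl }
    1 (fun f => by
      rw [one_mul]
      exact lp.norm_le_of_forall_sum_le (by norm_num) (norm_nonneg _) (sum_shiftFun_le φ f))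

theorem shiftOp_apply (φ : Tup ≃. Tup) (f : Fock) (γ : Tup) :
    shiftOp φ f γ = (φ.symm γ).elim 0 f := rfl

theorem inner_e (γ : Tup) (f : Fock) : inner ℂ (e γ) f = f γ := by
  classical
  have h := lp.inner_single_left (𝕜 := ℂ) (G := fun _ : Tup => ℂ) γ 1 f
  rw [e]
  convert h using 1
  simp

theorem e_apply (γ δ : Tup) [Decidable (δ = γ)] : e γ δ = if δ = γ then 1 else 0 := by
  classical
  rw [e, lp.single_apply]
  split_ifs with h
  · subst h; simp
  · simp [h]

theorem shiftOp_e (φ : Tup ≃. Tup) (γ : Tup) : shiftOp φ (e γ) = (φ γ).elim 0 e := by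
  classical
  ext δ
  rw [shiftOp_apply]
  cases hs : φ.symm δ with
  | none =>
    cases hp : φ γ with
    | none => simp
    | some b =>
      have : δ ≠ b := by
        rintro rfl
        rw [(PEquiv.eq_some_iff φ).2 hp] at hs
        cases hs
      simp [e_apply, this]
  | some a =>
    have ha := (PEquiv.eq_some_iff φ).1 hs
    cases hp : φ γ with
    | none =>
      have : a ≠ γ := by rintro rfl; rw [ha] at hp; cases hp
      simp [e_apply, this]
    | some b =>
      have : a = γ ↔ δ = b := by
        constructor
        · rintro rfl; rw [ha] at hp; exact Option.some.inj hp
        · rintro rfl; exact PEquiv.inj φ ha hp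
      simp [e_apply, this]

theorem star_shiftOp_apply (φ : Tup ≃. Tup) (f : Fock) (γ : Tup) :
    (star (shiftOp φ)) f γ = (φ γ).elim 0 f := by
  rw [← inner_e, ContinuousLinearMap.star_eq_adjoint, ContinuousLinearMap.adjoint_inner_right,
    shiftOp_e]
  cases φ γ with
  | none => simp
  | some b => exact inner_e b f

/-- The creator `A_i†`, `i ≥ 1`: `A_i† e_γ = e_i ⊗ e_γ` if `γ = ∅` or `i ≥ i_1`, and
`A_i† e_γ = 0` otherwise. -/
def creator (i : ℕ) : Fock →L[ℂ] Fock := shiftOp (Tup.pushEquiv i)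

/-- The orthogonal projection `P_Ω` onto the vacuum. -/
def vacuumProj : Fock →L[ℂ] Fock := (Submodule.span ℂ {vacuum}).starProjection

theorem norm_vacuum : ‖vacuum‖ = 1 := by
  classical
  rw [vacuum, e, lp.norm_single (by norm_num), norm_one]

theorem vacuumProj_apply (f : Fock) (γ : Tup) [Decidable (γ.head = 0)] :
    vacuumProj f γ = if γ.head = 0 then f γ else 0 := by
  classical
  have hh : γ.head = 0 ↔ γ = Tup.nil := Tup.head_eq_zero
  have h := Submodule.starProjection_unit_singleton ℂ norm_vacuum f
  rw [vacuumProj, h, vacuum, inner_e]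
  change f Tup.nil * e Tup.nil γ = _
  rw [e_apply]
  by_cases hγ : γ = Tup.nil
  · subst hγ; simp [hh]
  · simp [hh, hγ]

/-- The family `z P_Ω, A_1†, A_2†, …`. -/
def family (z : Circle) : ℕ → Fock →L[ℂ] Fock
  | 0 => (z : ℂ) • vacuumProj
  | i + 1 => creator (i + 1)

theorem creator_star_creator {i : ℕ} (hi : 1 ≤ i) (f : Fock) (γ : Tup) :
    (creator i * star (creator i)) f γ = if γ.head = i then f γ else 0 := by
  change shiftOp (Tup.pushEquiv i) (star (shiftOp (Tup.pushEquiv i)) f) γ = _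
  rw [shiftOp_apply]
  have h := Tup.pop_isSome (γ := γ) hi
  change (Tup.pop i γ).elim 0 _ = _
  cases hp : Tup.pop i γ with
  | none =>
    rw [hp] at h
    rw [if_neg fun h' => by simpa using h.2 h']
    rfl
  | some δ =>
    rw [hp] at h
    rw [if_pos (h.1 rfl)]
    change star (shiftOp (Tup.pushEquiv i)) f δ = _
    rw [star_shiftOp_apply]
    change (Tup.push i δ).elim 0 f = _
    rw [Tup.push_eq_some.2 (Tup.pop_eq_some.1 hp)]
    rfl

theorem star_creator_creator {i : ℕ} (hi : 1 ≤ i) (f : Fock) (γ : Tup) :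
    (star (creator i) * creator i) f γ = if γ.head ≤ i then f γ else 0 := by
  change star (shiftOp (Tup.pushEquiv i)) (shiftOp (Tup.pushEquiv i) f) γ = _
  rw [star_shiftOp_apply]
  have h := Tup.push_isSome (i := i) (γ := γ)
  change (Tup.push i γ).elim 0 _ = _
  cases hp : Tup.push i γ with
  | none =>
    rw [hp] at h
    rw [if_neg fun h' => by simpa using h.2 ⟨hi, h'⟩]
    rfl
  | some δ =>
    rw [hp] at h
    rw [if_pos (h.1 rfl).2]
    change shiftOp (Tup.pushEquiv i) f δ = _
    rw [shiftOp_apply]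
    change (Tup.pop i δ).elim 0 f = _
    rw [Tup.pop_eq_some.2 (Tup.push_eq_some.1 hp)]
    rfl

theorem creator_apply_ne {i : ℕ} (hi : 1 ≤ i) (f : Fock) (γ : Tup) (h : γ.head ≠ i) :
    creator i f γ = 0 := by
  change (Tup.pop i γ).elim 0 f = 0
  have h' := Tup.pop_isSome (γ := γ) hi
  cases hp : Tup.pop i γ with
  | none => rfl
  | some δ => rw [hp] at h'; exact (h (h'.1 rfl)).elim

theorem star_vacuumProj : star vacuumProj = vacuumProj :=
  (isSelfAdjoint_starProjection (Submodule.span ℂ {vacuum})).star_eq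

theorem family_mul_star (z : Circle) (k : ℕ) (f : Fock) (γ : Tup) :
    (family z k * star (family z k)) f γ = if γ.head = k then f γ else 0 := by
  cases k with
  | zero =>
    have hz : (z : ℂ) * star (z : ℂ) = 1 := by
      rw [Complex.star_def, Complex.mul_conj, Circle.normSq_coe]; norm_num
    have : family z 0 * star (family z 0) = vacuumProj * vacuumProj := by
      simp only [family, star_smul, star_vacuumProj]
      rw [smul_mul_smul_comm, hz, one_smul]
    rw [this]
    change vacuumProj (vacuumProj f) γ = _
    rw [vacuumProj_apply, vacuumProj_apply]
    split_ifs <;> rfl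
  | succ k => exact creator_star_creator (by omega) f γ

theorem star_mul_family (z : Circle) (k : ℕ) (f : Fock) (γ : Tup) :
    (star (family z k) * family z k) f γ = if γ.head ≤ k then f γ else 0 := by
  cases k with
  | zero =>
    have hz : star (z : ℂ) * (z : ℂ) = 1 := by
      rw [mul_comm, Complex.star_def, Complex.mul_conj, Circle.normSq_coe]; norm_num
    have : star (family z 0) * family z 0 = vacuumProj * vacuumProj := by
      simp only [family, star_smul, star_vacuumProj]
      rw [smul_mul_smul_comm, hz, one_smul]
    rw [this]
    change vacuumProj (vacuumProj f) γ = _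
    rw [vacuumProj_apply, vacuumProj_apply]
    simp only [Nat.le_zero]
    split_ifs <;> rfl
  | succ k => exact star_creator_creator (by omega) f γ

theorem family_apply_ne (z : Circle) (k : ℕ) (f : Fock) (γ : Tup) (h : γ.head ≠ k) :
    family z k f γ = 0 := by
  cases k with
  | zero =>
    change (z : ℂ) * vacuumProj f γ = 0
    rw [vacuumProj_apply, if_neg h, mul_zero]
  | succ k => exact creator_apply_ne (by omega) f γ h

theorem isWMFamily_family (z : Circle) : IsWMFamily (family z) where
  partialIsometry i := by
    ext f γ
    change (family z i * star (family z i)) (family z i f) γ = family z i f γ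
    rw [family_mul_star]
    split_ifs with h
    · rfl
    · exact (family_apply_ne z i f γ h).symm
  orthogonal i j hij := by
    have h : star (family z i) * family z j = 0 := by
      have h1 : family z i * star (family z i) * family z j = 0 := by
        ext f γ
        change (family z i * star (family z i)) (family z j f) γ = 0
        rw [family_mul_star]
        split_ifs with h
        · exact family_apply_ne z j f γ (by omega)
        · rfl
      have h2 : star (star (family z i) * family z j) * (star (family z i) * family z j) = 0 := by
        rw [star_mul, star_star, mul_assoc, ← mul_assoc (family z i), h1, mul_zero]
      exact CStarRing.star_mul_self_eq_zero_iff _ |>.1 h2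
    exact h
  support i := by
    ext f γ
    rw [star_mul_family, _root_.sum_apply, lp.coeFn_sum, Finset.sum_apply]
    simp only [family_mul_star]
    rw [Finset.sum_ite_eq]
    simp only [Finset.mem_range, Nat.lt_succ_iff]

end Fock

/-! ### Representations -/

section Representations

variable {A : Type*} [NonUnitalCStarAlgebra A]
  {H : Type*} [NormedAddCommGroup H] [InnerProductSpace ℂ H] [CompleteSpace H]
  {K : Type*} [NormedAddCommGroup K] [InnerProductSpace ℂ K] [CompleteSpace K]

/-- A representation is irreducible if it is non-zero and has no non-trivial closed
invariant subspace. -/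
def IsIrreducible (π : A →⋆ₙₐ[ℂ] (H →L[ℂ] H)) : Prop :=
  π ≠ 0 ∧ ∀ M : Submodule ℂ H, IsClosed (M : Set H) → (∀ a, ∀ x ∈ M, π a x ∈ M) → M = ⊥ ∨ M = ⊤

/-- Unitary equivalence of representations. -/
def UnitarilyEquivalent (π : A →⋆ₙₐ[ℂ] (H →L[ℂ] H)) (ρ : A →⋆ₙₐ[ℂ] (K →L[ℂ] K)) : Prop :=
  ∃ U : H ≃ₗᵢ[ℂ] K, ∀ a x, U (π a x) = ρ a (U x)

end Representations

/-- The representation `π̃_{0,z}` on the weakly monotone Fock space, with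
`s_0 ↦ z P_Ω` and `s_i ↦ A_i†` for `i ≥ 1`. -/
def piZero (z : Circle) : OA →⋆ₙₐ[ℂ] (Fock →L[ℂ] Fock) := OA.lift (Fock.isWMFamily_family z)

/-- The representation `π̃_{n,z} = π̃_{0,z} ∘ Ψ⁻¹ ∘ p_n` obtained from an isomorphism
`Ψ : O_{A_ℕ} → O_{A_ℕ} / J_n`. -/
def piTilde {n : ℕ} (Ψ : OA ≃⋆ₐ[ℂ] Q n) (z : Circle) : OA →⋆ₙₐ[ℂ] (Fock →L[ℂ] Fock) :=
  (piZero z).comp ((Ψ.symm : Q n →⋆ₙₐ[ℂ] OA).comp (proj n))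

end WM

end

/-!
Both `O_{A_ℕ}` and `O_{A_ℕ} / J_n` are universal for the weakly monotone relations, the latter
because a weakly monotone family whose first `n` members vanish is again weakly monotone after a
shift by `n`; this gives `Ψ_n`.

In an irreducible representation `π` with `π(s_0) ≠ 0`, any closed subspace reducing the normal
operator `S_0 = π(s_0)` generates, under the words in the `S_i`, a subspace reducing all of `π`, and
compressing back with the projection `S_0 S_0*` shows that `S_0` has no proper reducing subspace
inside its range. By the continuous functional calculus `S_0` then has at most one non-zero point in
its spectrum, which is some `z ∈ 𝕋`, so there is a unit vector `x` with `S_0 x = z x`. The words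
applied to `x` form an orthonormal basis on which the `S_i` act by formulas depending only on `z`;
hence `z` determines `π` up to unitary equivalence, and the vacuum of the Fock space realises every
`z`. A general irreducible representation is reduced to this case by dividing out the generators in
front of the first one that it does not annihilate.
-/

noncomputable section

open Finset Filter Topology
open scoped CStarAlgebra InnerProductSpace

namespace WM

section CStarQuotient

variable {A : Type*} [NonUnitalCStarAlgebra A]

section Order

variable [PartialOrder A] [StarOrderedRing A] {e : A}

theorem norm_sub_mul_left_le (he : 0 ≤ e) (he₁ : ‖e‖ ≤ 1) (z : A) : ‖z - e * z‖ ≤ ‖z‖ := by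
  refine CStarAlgebra.norm_sub_mul_self_le_of_inr z le_rfl he he₁ (norm_nonneg z) ?_
  rw [Unitization.inr_zero, sub_zero, mul_one, CStarRing.norm_star_mul_self,
    Unitization.norm_inr, sq]

theorem norm_sub_mul_right_le (he : 0 ≤ e) (he₁ : ‖e‖ ≤ 1) (z : A) : ‖z - z * e‖ ≤ ‖z‖ := by
  have h := norm_sub_mul_left_le he he₁ (star z)
  rwa [← norm_star, star_sub, star_mul, star_star, (IsSelfAdjoint.of_nonneg he).star_eq,
    norm_star] at h

theorem exists_nonneg_norm_sub_mul_lt {J : Submodule ℂ A} (hJ : IsClosed (J : Set A))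
    (hmul : ∀ a : A, ∀ x ∈ J, a * x ∈ J) (hstar : ∀ x ∈ J, star x ∈ J) {j : A} (hj : j ∈ J)
    {ε : ℝ} (hε : 0 < ε) : ∃ e ∈ J, 0 ≤ e ∧ ‖e‖ ≤ 1 ∧ ‖j - j * e‖ < ε := by
  let B : NonUnitalStarSubalgebra ℂ A :=
    { J with
      mul_mem' := fun _ hb => hmul _ _ hb
      star_mem' := fun ha => hstar _ ha }
  have : IsClosed (B : Set A) := hJ
  let _ := CStarAlgebra.spectralOrder B
  have := CStarAlgebra.spectralOrderedRing B
  have hu := CStarAlgebra.increasingApproximateUnit B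
  obtain ⟨e, hje, he, he₁⟩ := ((Metric.tendsto_nhds.1 (hu.tendsto_mul_left ⟨j, hj⟩) ε hε).and
    (hu.eventually_nonneg.and hu.eventually_norm)).exists
  obtain ⟨b, rfl⟩ := CStarAlgebra.nonneg_iff_eq_star_mul_self.1 he
  rw [dist_comm, dist_eq_norm] at hje
  exact ⟨star b * b, (star b * b).2, star_mul_self_nonneg (b : A), he₁, hje⟩

theorem norm_mkQ_mul_self_le_norm_sub {J : Submodule ℂ A} (hmul : ∀ a : A, ∀ x ∈ J, a * x ∈ J)
    (heJ : e ∈ J) (he : 0 ≤ e) (he₁ : ‖e‖ ≤ 1) (x : A) :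
    ‖J.mkQ x‖ * ‖J.mkQ x‖ ≤ ‖star x * x - star x * x * e‖ := by
  have hle : ‖J.mkQ x‖ ≤ ‖x - x * e‖ := by
    have h : J.mkQ x = J.mkQ (x - x * e) :=
      (Submodule.Quotient.eq J).2 (by rw [sub_sub_cancel]; exact hmul _ _ heJ)
    exact h ▸ Submodule.Quotient.norm_mk_le _ _
  calc ‖J.mkQ x‖ * ‖J.mkQ x‖ ≤ ‖x - x * e‖ * ‖x - x * e‖ :=
        mul_self_le_mul_self (norm_nonneg _) hle
    _ = ‖(star x * x - star x * x * e) - e * (star x * x - star x * x * e)‖ := by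
        rw [← CStarRing.norm_star_mul_self, star_sub, star_mul,
          (IsSelfAdjoint.of_nonneg he).star_eq]
        congr 1
        noncomm_ring
    _ ≤ ‖star x * x - star x * x * e‖ := norm_sub_mul_left_le he he₁ _

end Order

theorem norm_mkQ_mul_self_le {J : Submodule ℂ A} (hJ : IsClosed (J : Set A))
    (hmul : ∀ a : A, ∀ x ∈ J, a * x ∈ J) (hstar : ∀ x ∈ J, star x ∈ J) (x : A) :
    ‖J.mkQ x‖ * ‖J.mkQ x‖ ≤ ‖J.mkQ (star x * x)‖ := by
  let _ := CStarAlgebra.spectralOrder A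
  have := CStarAlgebra.spectralOrderedRing A
  refine le_of_forall_pos_lt_add fun ε hε => ?_
  obtain ⟨y, hy, hyε⟩ := Submodule.Quotient.norm_mk_lt (J.mkQ (star x * x)) (half_pos hε)
  have hj : star x * x - y ∈ J := (Submodule.Quotient.eq J).1 hy.symm
  obtain ⟨e, heJ, he, he₁, hje⟩ := exists_nonneg_norm_sub_mul_lt hJ hmul hstar hj (half_pos hε)
  calc ‖J.mkQ x‖ * ‖J.mkQ x‖ ≤ ‖star x * x - star x * x * e‖ :=
        norm_mkQ_mul_self_le_norm_sub hmul heJ he he₁ x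
    _ = ‖(y - y * e) + ((star x * x - y) - (star x * x - y) * e)‖ := by
        congr 1
        noncomm_ring
    _ ≤ ‖y - y * e‖ + ‖(star x * x - y) - (star x * x - y) * e‖ := norm_add_le _ _
    _ < ‖J.mkQ (star x * x)‖ + ε / 2 + ε / 2 :=
        add_lt_add ((norm_sub_mul_right_le he he₁ y).trans_lt hyε) hje
    _ = ‖J.mkQ (star x * x)‖ + ε := by rw [add_assoc, add_halves]

theorem subset_closedIdeal (T : Set A) : T ⊆ closedIdeal T := by
  intro x hx
  simp only [closedIdeal, SetLike.mem_coe, Submodule.mem_sInf]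
  exact fun J hJ => hJ.2.2 hx

theorem isClosed_closedIdeal (T : Set A) : IsClosed (closedIdeal T : Set A) := by
  rw [closedIdeal, Submodule.coe_sInf]
  exact isClosed_biInter fun J hJ => hJ.1

theorem map_eq_zero_of_mem_closedIdeal {B : Type*} [NonUnitalCStarAlgebra B] {T : Set A}
    (φ : A →⋆ₙₐ[ℂ] B) (hφ : ∀ x ∈ T, φ x = 0) {x : A} (hx : x ∈ closedIdeal T) : φ x = 0 := by
  rw [closedIdeal, Submodule.mem_sInf] at hx
  refine hx (LinearMap.ker (φ : A →ₗ[ℂ] B))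
    ⟨isClosed_eq (map_continuous φ) continuous_const, fun a y hy => ?_, hφ⟩
  have hy₀ : φ y = 0 := hy
  constructor
  · change φ (a * y) = 0
    rw [map_mul, hy₀, mul_zero]
  · change φ (y * a) = 0
    rw [map_mul, hy₀, zero_mul]

end CStarQuotient

theorem proj_surjective (n : ℕ) : Function.Surjective (proj n) :=
  Submodule.Quotient.mk_surjective _

theorem proj_s_of_lt {i n : ℕ} (h : i < n) : proj n (OA.s i) = 0 :=
  (Submodule.Quotient.mk_eq_zero _).2 (subset_closedIdeal _ ⟨i, h, rfl⟩)

namespace Q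

variable {n : ℕ}

instance : IsClosed (idealJ n : Set OA) := isClosed_closedIdeal _

instance : NonUnitalNormedRing (Q n) where
  __ := (inferInstance : NonUnitalRing (Q n))
  __ := (inferInstance : NormedAddCommGroup (Q n))
  norm_mul_le x y := by
    refine le_mul_of_forall_lt₀ fun a' ha b' hb => ?_
    obtain ⟨a, rfl, haa'⟩ := Submodule.Quotient.norm_mk_lt x (sub_pos.2 ha)
    obtain ⟨b, rfl, hbb'⟩ := Submodule.Quotient.norm_mk_lt y (sub_pos.2 hb)
    rw [add_sub_cancel] at haa' hbb'
    calc ‖(Submodule.Quotient.mk (a * b) : Q n)‖ ≤ ‖a * b‖ := Submodule.Quotient.norm_mk_le _ _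
      _ ≤ ‖a‖ * ‖b‖ := norm_mul_le a b
      _ ≤ a' * b' := mul_le_mul haa'.le hbb'.le (norm_nonneg b) ((norm_nonneg a).trans haa'.le)

instance : NonUnitalCStarAlgebra (Q n) where
  __ := (inferInstance : CompleteSpace (Q n))
  __ := (inferInstance : NormedSpace ℂ (Q n))
  __ := (inferInstance : IsScalarTower ℂ (Q n) (Q n))
  __ := (inferInstance : SMulCommClass ℂ (Q n) (Q n))
  __ := (inferInstance : StarModule ℂ (Q n))
  norm_mul_self_le x := by
    obtain ⟨a, rfl⟩ := Submodule.Quotient.mk_surjective _ x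
    exact norm_mkQ_mul_self_le (isClosed_closedIdeal _) (fun a _ => idealJ_mul_left a)
      (fun _ => idealJ_star) a

section Lift

variable {A : Type*} [NonUnitalCStarAlgebra A]

/-- The factorisation through `p_n` of a homomorphism which kills `s_0, …, s_{n-1}`. -/
def lift (φ : OA →⋆ₙₐ[ℂ] A) (hφ : ∀ i < n, φ (OA.s i) = 0) : Q n →⋆ₙₐ[ℂ] A where
  __ := (idealJ n).liftQ (φ : OA →ₗ[ℂ] A) fun _ =>
    map_eq_zero_of_mem_closedIdeal φ (by rintro _ ⟨i, hi, rfl⟩; exact hφ i hi)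
  map_zero' := map_zero _
  map_mul' := by
    rintro ⟨a⟩ ⟨b⟩
    exact map_mul φ a b
  map_star' := by
    rintro ⟨a⟩
    exact map_star φ a

theorem lift_proj (φ : OA →⋆ₙₐ[ℂ] A) (hφ : ∀ i < n, φ (OA.s i) = 0) (x : OA) :
    lift φ hφ (proj n x) = φ x := rfl

end Lift

end Q

namespace OA

theorem eq_top_of_s_mem {B : NonUnitalStarSubalgebra ℂ OA} (hB : IsClosed (B : Set OA))
    (hs : ∀ i, s i ∈ B) : B = ⊤ := by
  refine eq_top_iff.2 fun x _ => ind (p := (· ∈ B)) x hB fun a => ?_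
  induction a using Free.induction with
  | hgen i => exact hs i
  | h0 => exact zero_mem B
  | hadd a b ha hb => exact coe_add a b ▸ add_mem ha hb
  | hmul a b ha hb => exact coe_mul a b ▸ mul_mem ha hb
  | hsmul r a ha => exact coe_smul r a ▸ SMulMemClass.smul_mem r ha
  | hstar a ha => exact coe_star a ▸ star_mem ha

theorem hom_ext {A : Type*} [NonUnitalCStarAlgebra A] {φ ψ : OA →⋆ₙₐ[ℂ] A}
    (h : ∀ i, φ (s i) = ψ (s i)) : φ = ψ := by
  have htop : NonUnitalStarAlgHom.equalizer φ ψ = ⊤ :=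
    eq_top_of_s_mem (isClosed_eq (map_continuous φ) (map_continuous ψ)) h
  exact NonUnitalStarAlgHom.ext fun x => htop.ge (NonUnitalStarAlgebra.mem_top (x := x))

end OA

namespace IsWMFamily

theorem map {A B F : Type*} [NonUnitalRing A] [StarRing A] [NonUnitalRing B] [StarRing B]
    [FunLike F A B] [NonUnitalRingHomClass F A B] [StarHomClass F A B] {S : ℕ → A}
    (hS : IsWMFamily S) (φ : F) : IsWMFamily fun i => φ (S i) where
  partialIsometry i := by rw [← map_star, ← map_mul, ← map_mul, hS.partialIsometry]
  orthogonal i j h := by rw [← map_star, ← map_mul, hS.orthogonal i j h, map_zero]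
  support i := by simp only [← map_star, ← map_mul, ← map_sum, hS.support]

end IsWMFamily

section Shift

variable {A : Type*} [NonUnitalRing A] [StarRing A] {S : ℕ → A} {n : ℕ}

theorem sum_range_add_mul_star_of_eq_zero (h₀ : ∀ i < n, S i = 0) (m : ℕ) :
    ∑ k ∈ range (m + n), S k * star (S k) = ∑ k ∈ range m, S (k + n) * star (S (k + n)) := by
  rw [add_comm, sum_range_add, sum_eq_zero fun k hk => by rw [h₀ k (mem_range.1 hk), zero_mul],
    zero_add]
  simp only [add_comm n]

theorem isWMFamily_add_iff (h₀ : ∀ i < n, S i = 0) :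
    IsWMFamily (fun i => S (i + n)) ↔ IsWMFamily S := by
  refine ⟨fun hS => ⟨fun i => ?_, fun i j hij => ?_, fun i => ?_⟩, fun hS => ⟨fun i => ?_,
    fun i j hij => hS.orthogonal _ _ (by omega), fun i => ?_⟩⟩
  · rcases lt_or_ge i n with hi | hi
    · rw [h₀ i hi, mul_zero]
    · have h := hS.partialIsometry (i - n)
      rwa [Nat.sub_add_cancel hi] at h
  · rcases lt_or_ge i n with hi | hi
    · rw [h₀ i hi, star_zero, zero_mul]
    rcases lt_or_ge j n with hj | hj
    · rw [h₀ j hj, mul_zero]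
    have h := hS.orthogonal (i - n) (j - n) (by omega)
    rwa [Nat.sub_add_cancel hi, Nat.sub_add_cancel hj] at h
  · rcases lt_or_ge i n with hi | hi
    · rw [h₀ i hi, mul_zero, sum_eq_zero]
      intro k hk
      rw [h₀ k (by rw [mem_range] at hk; omega), zero_mul]
    · have h := hS.support (i - n)
      rwa [Nat.sub_add_cancel hi, ← sum_range_add_mul_star_of_eq_zero h₀,
        show i - n + 1 + n = i + 1 by omega] at h
  · exact hS.partialIsometry _
  · rw [hS.support, add_right_comm, sum_range_add_mul_star_of_eq_zero h₀]

end Shift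

theorem isWMFamily_unshift (n : ℕ) : IsWMFamily fun i => if i < n then 0 else OA.s (i - n) := by
  refine (isWMFamily_add_iff (n := n) fun i hi => if_pos hi).1 ?_
  simpa only [not_lt.2 (Nat.le_add_left n _), if_false, Nat.add_sub_cancel] using OA.isWMFamily_s

/-- The endomorphism of `O_{A_ℕ}` with `s_i ↦ 0` for `i < n` and `s_{i+n} ↦ s_i`. -/
def unshift (n : ℕ) : OA →⋆ₙₐ[ℂ] OA := OA.lift (isWMFamily_unshift n)

theorem unshift_s_of_lt {n i : ℕ} (h : i < n) : unshift n (OA.s i) = 0 :=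
  (OA.lift_s _ i).trans (if_pos h)

theorem unshift_s_add (n i : ℕ) : unshift n (OA.s (i + n)) = OA.s i := by
  rw [unshift, OA.lift_s, if_neg (by omega), Nat.add_sub_cancel]

/-- The homomorphism `O_{A_ℕ} → O_{A_ℕ} / J_n` with `s_i ↦ p_n(s_{i+n})`. -/
def shiftHom (n : ℕ) : OA →⋆ₙₐ[ℂ] Q n :=
  OA.lift ((isWMFamily_add_iff fun _ => proj_s_of_lt).2 (OA.isWMFamily_s.map (proj n)))

theorem shiftHom_s (n i : ℕ) : shiftHom n (OA.s i) = proj n (OA.s (i + n)) := OA.lift_s _ i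

theorem shiftHom_unshift (n : ℕ) (x : OA) : shiftHom n (unshift n x) = proj n x := by
  refine DFunLike.congr_fun (f := (shiftHom n).comp (unshift n)) (OA.hom_ext fun i => ?_) x
  rw [NonUnitalStarAlgHom.comp_apply]
  rcases lt_or_ge i n with hi | hi
  · rw [unshift_s_of_lt hi, map_zero, proj_s_of_lt hi]
  · obtain ⟨k, rfl⟩ := Nat.exists_eq_add_of_le' hi
    rw [unshift_s_add, shiftHom_s]

theorem lift_unshift_shiftHom (n : ℕ) (x : OA) :
    Q.lift (unshift n) (fun _ => unshift_s_of_lt) (shiftHom n x) = x := by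
  refine DFunLike.congr_fun (f := (Q.lift (unshift n) fun _ => unshift_s_of_lt).comp
    (shiftHom n)) (g := NonUnitalStarAlgHom.id ℂ OA) (OA.hom_ext fun i => ?_) x
  rw [NonUnitalStarAlgHom.comp_apply, shiftHom_s, Q.lift_proj, unshift_s_add]
  rfl

theorem bijective_shiftHom (n : ℕ) : Function.Bijective (shiftHom n) := by
  refine ⟨Function.LeftInverse.injective (lift_unshift_shiftHom n), fun y => ?_⟩
  obtain ⟨x, rfl⟩ := proj_surjective n y
  exact ⟨unshift n x, shiftHom_unshift n x⟩

theorem existsUnique_shiftEquiv (n : ℕ) :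
    ∃! Ψ : OA ≃⋆ₐ[ℂ] Q n, ∀ i, Ψ (OA.s i) = proj n (OA.s (i + n)) := by
  refine ⟨StarAlgEquiv.ofBijective (shiftHom n) (bijective_shiftHom n), shiftHom_s n,
    fun Ψ hΨ => StarAlgEquiv.ext fun x => ?_⟩
  exact DFunLike.congr_fun (f := (Ψ : OA →⋆ₙₐ[ℂ] Q n))
    (OA.hom_ext fun i => (hΨ i).trans (shiftHom_s n i).symm) x

namespace Tup

variable {i : ℕ} {γ δ : Tup}

theorem one_le_of_push (h : push i γ = some δ) : 1 ≤ i :=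
  (push_isSome.1 (Option.isSome_of_eq_some h)).1

theorem head_le_of_push (h : push i γ = some δ) : γ.head ≤ i :=
  (push_isSome.1 (Option.isSome_of_eq_some h)).2

theorem head_of_push (h : push i γ = some δ) : δ.head = i := by
  rw [head, push_eq_some.1 h, List.headD_cons]

theorem one_le_head (h : γ ≠ nil) : 1 ≤ γ.head :=
  Nat.one_le_iff_ne_zero.2 (mt head_eq_zero.1 h)

theorem exists_push (hi : 1 ≤ i) (h : δ.head = i) : ∃ γ, push i γ = some δ := by
  obtain ⟨γ, hγ⟩ := Option.isSome_iff_exists.1 ((pop_isSome hi).2 h)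
  exact ⟨γ, push_eq_some.2 (pop_eq_some.1 hγ)⟩

theorem push_inj_left {γ' : Tup} (h : push i γ = some δ) (h' : push i γ' = some δ) : γ = γ' :=
  Tup.ext (List.cons.inj ((push_eq_some.1 h).symm.trans (push_eq_some.1 h'))).2

theorem induction {P : Tup → Prop} (nil : P nil)
    (push : ∀ {i γ δ}, push i γ = some δ → P γ → P δ) (γ : Tup) : P γ := by
  obtain ⟨l, hl⟩ : ∃ l, γ.val = l := ⟨_, rfl⟩
  induction l generalizing γ with
  | nil => exact (Tup.ext hl : γ = Tup.nil) ▸ nil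
  | cons i l ih =>
    obtain ⟨γ', hγ'⟩ := exists_push (δ := γ) (one_le_head fun h => by rw [h] at hl; cases hl) rfl
    exact push hγ' (ih γ' (List.cons.inj ((push_eq_some.1 hγ').symm.trans hl)).2)

end Tup

/-- The product `S_{i_1} ⋯ S_{i_k}` for `γ = (i_1, …, i_k)`. -/
def word {A : Type*} [Monoid A] (S : ℕ → A) (γ : Tup) : A := (γ.val.map S).prod

section Word

variable {A : Type*} [Monoid A] {S : ℕ → A}

theorem word_nil : word S Tup.nil = 1 := rfl

theorem word_of_push {i : ℕ} {γ δ : Tup} (h : Tup.push i γ = some δ) :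
    word S δ = S i * word S γ := by
  rw [word, word, Tup.push_eq_some.1 h, List.map_cons, List.prod_cons]

theorem exists_word_mul_eq_head_mul (S : ℕ → A) (γ : Tup) :
    ∃ b, word S γ * S 0 = S γ.head * b := by
  by_cases hγ : γ = Tup.nil
  · exact ⟨1, by rw [Tup.head_eq_zero.2 hγ, hγ, word_nil, one_mul, mul_one]⟩
  · obtain ⟨γ', h⟩ := Tup.exists_push (Tup.one_le_head hγ) rfl
    exact ⟨word S γ' * S 0, by rw [word_of_push h, mul_assoc]⟩

end Word

namespace IsWMFamily

section NonUnital

variable {A : Type*} [NonUnitalRing A] [StarRing A] {S : ℕ → A} {i j : ℕ}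

theorem star_mul_self_mul_of_le (hS : IsWMFamily S) (h : j ≤ i) :
    star (S i) * S i * S j = S j := by
  rw [hS.support, sum_mul, sum_eq_single_of_mem j (by rw [mem_range]; omega),
    hS.partialIsometry]
  intro k _ hkj
  rw [mul_assoc, hS.orthogonal k j hkj, mul_zero]

theorem mul_eq_zero_of_lt (hS : IsWMFamily S) (h : i < j) : S i * S j = 0 := by
  have hsupp : star (S i) * S i * S j = 0 := by
    rw [hS.support, sum_mul]
    refine sum_eq_zero fun k hk => ?_
    rw [mul_assoc, hS.orthogonal k j (by rw [mem_range] at hk; omega), mul_zero]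
  rw [← hS.partialIsometry i, mul_assoc, mul_assoc, ← mul_assoc (star _), hsupp, mul_zero]

theorem star_zero_mul_zero (hS : IsWMFamily S) : star (S 0) * S 0 = S 0 * star (S 0) := by
  rw [hS.support, sum_range_one]

end NonUnital

variable {A : Type*} [Ring A] [StarRing A] {S : ℕ → A} {i : ℕ} {γ δ : Tup}

theorem star_mul_word_of_head_ne (hS : IsWMFamily S) (h : γ.head ≠ i) :
    star (S i) * (word S γ * S 0) = 0 := by
  obtain ⟨b, hb⟩ := exists_word_mul_eq_head_mul S γ
  rw [hb, ← mul_assoc, hS.orthogonal i _ h.symm, zero_mul]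

theorem mul_word_of_lt_head (hS : IsWMFamily S) (h : i < γ.head) :
    S i * (word S γ * S 0) = 0 := by
  obtain ⟨b, hb⟩ := exists_word_mul_eq_head_mul S γ
  rw [hb, ← mul_assoc, hS.mul_eq_zero_of_lt h, zero_mul]

theorem star_mul_word_of_push (hS : IsWMFamily S) (h : Tup.push i γ = some δ) :
    star (S i) * (word S δ * S 0) = word S γ * S 0 := by
  obtain ⟨b, hb⟩ := exists_word_mul_eq_head_mul S γ
  rw [word_of_push h, mul_assoc, hb, ← mul_assoc, ← mul_assoc,
    hS.star_mul_self_mul_of_le (Tup.head_le_of_push h)]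

open Classical in
theorem star_word_mul_word (hS : IsWMFamily S) (γ δ : Tup) :
    star (word S γ * S 0) * (word S δ * S 0) = if γ = δ then star (S 0) * S 0 else 0 := by
  induction γ using Tup.induction generalizing δ with
  | nil =>
    rw [word_nil, one_mul]
    split_ifs with h
    · rw [← h, word_nil, one_mul]
    · exact hS.star_mul_word_of_head_ne fun h₀ => h (Tup.head_eq_zero.1 h₀).symm
  | push hγ ih =>
    rename_i i γ' γ
    rw [word_of_push hγ, mul_assoc, star_mul, mul_assoc]
    by_cases hi : δ.head = i
    · obtain ⟨δ', hδ⟩ := Tup.exists_push (Tup.one_le_of_push hγ) hi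
      have hiff : γ' = δ' ↔ γ = δ :=
        ⟨fun h => Option.some.inj (hγ.symm.trans (h ▸ hδ)),
          fun h => Tup.push_inj_left hγ (h ▸ hδ)⟩
      rw [hS.star_mul_word_of_push hδ, ih, if_congr hiff rfl rfl]
    · rw [hS.star_mul_word_of_head_ne hi, mul_zero, if_neg]
      rintro rfl
      exact hi (Tup.head_of_push hγ)

end IsWMFamily

theorem exists_continuous_mul_eq_zero {X : Type*} [MetricSpace X] {x y : X} (hxy : x ≠ y) :
    ∃ f g : X → ℂ, Continuous f ∧ Continuous g ∧ f x ≠ 0 ∧ g y ≠ 0 ∧ ∀ t, f t * g t = 0 := by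
  have hpos : 0 < dist x y := dist_pos.2 hxy
  refine ⟨fun t => (max 0 (dist t y - dist t x) : ℝ), fun t => (max 0 (dist t x - dist t y) : ℝ),
    by fun_prop, by fun_prop, ?_, ?_, fun t => ?_⟩
  · simpa using hpos
  · simpa [dist_comm y x] using hpos
  · rw [← Complex.ofReal_mul, Complex.ofReal_eq_zero, mul_eq_zero]
    exact (le_total (dist t y) (dist t x)).imp (fun h => max_eq_left (sub_nonpos.2 h))
      fun h => max_eq_left (sub_nonpos.2 h)

section Reducing

variable {H : Type*} [NormedAddCommGroup H] [InnerProductSpace ℂ H] [CompleteSpace H]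
  {M : Submodule ℂ H} {a : H →L[ℂ] H}

/-- The operators which are reduced by the subspace `M`: both they and their adjoints leave `M`
invariant. -/
def reducedBy (M : Submodule ℂ H) : StarSubalgebra ℂ (H →L[ℂ] H) where
  carrier := {T | (∀ x ∈ M, T x ∈ M) ∧ ∀ x ∈ M, star T x ∈ M}
  mul_mem' hS hT := ⟨fun x hx => hS.1 _ (hT.1 x hx), fun x hx => by
    rw [star_mul]
    exact hT.2 _ (hS.2 x hx)⟩
  add_mem' hS hT := ⟨fun x hx => M.add_mem (hS.1 x hx) (hT.1 x hx), fun x hx => by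
    rw [star_add]
    exact M.add_mem (hS.2 x hx) (hT.2 x hx)⟩
  algebraMap_mem' r := ⟨fun x hx => M.smul_mem r hx, fun x hx => by
    rw [← algebraMap_star_comm]
    exact M.smul_mem _ hx⟩
  star_mem' hT := ⟨hT.2, by rw [star_star]; exact hT.1⟩

theorem mem_reducedBy : a ∈ reducedBy M ↔ (∀ x ∈ M, a x ∈ M) ∧ ∀ x ∈ M, star a x ∈ M := Iff.rfl

theorem isClosed_reducedBy (hM : IsClosed (M : Set H)) :
    IsClosed (reducedBy M : Set (H →L[ℂ] H)) := by
  have heq : (reducedBy M : Set (H →L[ℂ] H)) =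
      (⋂ x ∈ M, {T : H →L[ℂ] H | T x ∈ M}) ∩ ⋂ x ∈ M, {T : H →L[ℂ] H | star T x ∈ M} := by
    ext T
    simp only [SetLike.mem_coe, mem_reducedBy, Set.mem_inter_iff, Set.mem_iInter, Set.mem_ofPred_eq]
  rw [heq]
  exact (isClosed_biInter fun x _ => hM.preimage (by fun_prop)).inter
    (isClosed_biInter fun x _ => hM.preimage (by fun_prop))

theorem mem_reducedBy_ker {T : H →L[ℂ] H} (h : Commute T a) (h' : Commute T (star a)) :
    a ∈ reducedBy T.toLinearMap.ker := by
  have hker : ∀ b : H →L[ℂ] H, Commute T b → ∀ x, T x = 0 → T (b x) = 0 := fun b hb x hx => by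
    change (T * b) x = 0
    rw [hb.eq]
    exact (congrArg b hx).trans (map_zero b)
  exact ⟨hker a h, hker _ h'⟩

section Scalar

variable (ha : IsStarNormal a)
  (hmin : ∀ M : Submodule ℂ H, IsClosed (M : Set H) → a ∈ reducedBy M →
    (∀ x ∈ M, a x = 0) ∨ ∀ x, a x ∈ M)
include ha hmin

theorem cfc_mul_eq_zero_or_cfc_mul_eq_zero {f g : ℂ → ℂ} (hf : Continuous f) (hg : Continuous g)
    (hfg : ∀ t, f t * g t = 0) :
    cfc (fun t => f t * t) a = 0 ∨ cfc (fun t => g t * t) a = 0 := by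
  have hmul : cfc f a * cfc g a = 0 := by
    rw [← cfc_mul f g a, ← cfc_const_zero ℂ a]
    exact congrArg (cfc · a) (funext hfg)
  have hcomm : Commute (cfc f a) a := (Commute.refl a).cfc ha.star_comm_self f
  have hcomm' : Commute (cfc f a) (star a) := ha.star_comm_self.symm.cfc (Commute.refl _) f
  rw [cfc_mul f (fun t => t) a, cfc_mul g (fun t => t) a, cfc_id' ℂ a]
  have hred : a ∈ reducedBy (cfc f a).toLinearMap.ker := mem_reducedBy_ker hcomm hcomm'
  rcases hmin _ (ContinuousLinearMap.isClosed_ker (cfc f a)) hred with h | h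
  · right
    rw [((Commute.refl a).cfc ha.star_comm_self g).eq]
    exact ContinuousLinearMap.ext fun x => h _ (DFunLike.congr_fun hmul x)
  · exact Or.inl (ContinuousLinearMap.ext h)

theorem eq_of_mem_spectrum_of_ne_zero {z w : ℂ} (hz : z ∈ spectrum ℂ a) (hw : w ∈ spectrum ℂ a)
    (hz₀ : z ≠ 0) (hw₀ : w ≠ 0) : z = w := by
  by_contra hzw
  obtain ⟨f, g, hf, hg, hfz, hgw, hfg⟩ := exists_continuous_mul_eq_zero hzw
  have hvanish : ∀ h : ℂ → ℂ, Continuous h → cfc (fun t => h t * t) a = 0 →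
      ∀ t ∈ spectrum ℂ a, h t * t = 0 := fun h hh h₀ t ht => by
    rw [← cfc_const_zero ℂ a] at h₀
    have heqOn : (spectrum ℂ a).EqOn (fun t => h t * t) fun _ => 0 :=
      eqOn_of_cfc_eq_cfc h₀ (hf := by fun_prop)
    exact heqOn ht
  rcases cfc_mul_eq_zero_or_cfc_mul_eq_zero ha hmin hf hg hfg with h | h
  · exact mul_ne_zero hfz hz₀ (hvanish f hf h z hz)
  · exact mul_ne_zero hgw hw₀ (hvanish g hg h w hw)

theorem exists_mul_self_eq_smul : ∃ z : ℂ, a * a = z • a := by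
  obtain ⟨z, hz⟩ : ∃ z, ∀ t ∈ spectrum ℂ a, t ≠ 0 → t = z := by
    by_cases h : ∃ z ∈ spectrum ℂ a, z ≠ 0
    · obtain ⟨z, hz, hz₀⟩ := h
      exact ⟨z, fun t ht ht₀ => eq_of_mem_spectrum_of_ne_zero ha hmin ht hz ht₀ hz₀⟩
    · exact ⟨0, fun t ht ht₀ => (h ⟨t, ht, ht₀⟩).elim⟩
  refine ⟨z, ?_⟩
  rw [← cfc_id' ℂ a, ← cfc_mul (fun t => t) (fun t => t) a, ← cfc_const_mul z (fun t => t) a]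
  refine cfc_congr fun t ht => ?_
  by_cases ht₀ : t = 0
  · simp only [ht₀, mul_zero]
  · simp only [hz t ht ht₀]

end Scalar

end Reducing

section Vacuum

variable {H : Type*} [NormedAddCommGroup H] [InnerProductSpace ℂ H]

/-- The closed linear span of the vectors `S_{i_1} ⋯ S_{i_k} S_0 x` with `x ∈ M`. -/
def wordSpan (S : ℕ → H →L[ℂ] H) (M : Submodule ℂ H) : Submodule ℂ H :=
  (Submodule.span ℂ {v | ∃ γ, ∃ x ∈ M, (word S γ * S 0) x = v}).topologicalClosure

theorem isClosed_wordSpan (S : ℕ → H →L[ℂ] H) (M : Submodule ℂ H) :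
    IsClosed (wordSpan S M : Set H) :=
  Submodule.isClosed_topologicalClosure _

theorem word_mul_zero_mem_wordSpan (S : ℕ → H →L[ℂ] H) {M : Submodule ℂ H} (γ : Tup) {x : H}
    (hx : x ∈ M) : (word S γ * S 0) x ∈ wordSpan S M :=
  Submodule.le_topologicalClosure _ (Submodule.subset_span ⟨γ, x, hx, rfl⟩)

theorem mapsTo_wordSpan {S : ℕ → H →L[ℂ] H} {M N : Submodule ℂ H} {T : H →L[ℂ] H}
    (hN : IsClosed (N : Set H)) (h : ∀ γ, ∀ x ∈ M, (T * (word S γ * S 0)) x ∈ N) :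
    ∀ v ∈ wordSpan S M, T v ∈ N := by
  have hle : wordSpan S M ≤ N.comap T.toLinearMap := by
    refine Submodule.topologicalClosure_minimal _ (Submodule.span_le.2 ?_)
      (hN.preimage T.continuous)
    rintro _ ⟨γ, x, hx, rfl⟩
    exact h γ x hx
  exact fun v hv => hle hv

/-- A unit vector `x` is a vacuum vector of weight `z` for the operators `S_i` if `S_0 x = z x`. -/
structure IsVacuum (S : ℕ → H →L[ℂ] H) (z : Circle) (x : H) : Prop where
  norm_eq_one : ‖x‖ = 1
  zero_apply : S 0 x = (z : ℂ) • x

namespace IsVacuum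

variable {S : ℕ → H →L[ℂ] H} {z : Circle} {x : H}

theorem ne_zero (hx : IsVacuum S z x) : x ≠ 0 :=
  norm_ne_zero_iff.1 (hx.norm_eq_one.trans_ne one_ne_zero)

theorem zero_ne_zero (hx : IsVacuum S z x) : S 0 ≠ 0 := fun h => by
  have hzero := hx.zero_apply
  rw [h] at hzero
  exact smul_ne_zero z.coe_ne_zero hx.ne_zero hzero.symm

end IsVacuum

variable [CompleteSpace H] {S : ℕ → H →L[ℂ] H} {M : Submodule ℂ H}

theorem IsWMFamily.mem_reducedBy_wordSpan (hS : IsWMFamily S) (hM : S 0 ∈ reducedBy M) (i : ℕ) :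
    S i ∈ reducedBy (wordSpan S M) := by
  refine ⟨mapsTo_wordSpan (isClosed_wordSpan S M) fun γ x hx => ?_,
    mapsTo_wordSpan (isClosed_wordSpan S M) fun γ x hx => ?_⟩
  · rcases lt_or_ge i γ.head with hi | hi
    · rw [hS.mul_word_of_lt_head hi]
      exact zero_mem _
    rcases Nat.eq_zero_or_pos i with rfl | hpos
    · obtain rfl := Tup.head_eq_zero.1 (Nat.le_zero.1 hi)
      exact word_mul_zero_mem_wordSpan S Tup.nil (hM.1 x hx)
    · obtain ⟨δ, hδ⟩ := Option.isSome_iff_exists.1 (Tup.push_isSome.2 ⟨hpos, hi⟩)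
      rw [← mul_assoc, ← word_of_push hδ]
      exact word_mul_zero_mem_wordSpan S δ hx
  · rcases ne_or_eq γ.head i with hi | rfl
    · rw [hS.star_mul_word_of_head_ne hi]
      exact zero_mem _
    by_cases hγ : γ = Tup.nil
    · rw [hγ, Tup.head_eq_zero.2 rfl, word_nil, one_mul, hS.star_zero_mul_zero]
      exact word_mul_zero_mem_wordSpan S Tup.nil (hM.2 x hx)
    · obtain ⟨δ, hδ⟩ := Tup.exists_push (Tup.one_le_head hγ) rfl
      rw [hS.star_mul_word_of_push hδ]
      exact word_mul_zero_mem_wordSpan S δ hx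

theorem IsWMFamily.zero_apply_mem_of_wordSpan_eq_top (hS : IsWMFamily S)
    (hM : IsClosed (M : Set H)) (hred : S 0 ∈ reducedBy M) (htop : wordSpan S M = ⊤) (y : H) :
    S 0 y ∈ M := by
  have hrange : ∀ v ∈ wordSpan S M, (S 0 * star (S 0)) v ∈ M := by
    refine mapsTo_wordSpan hM fun γ x hx => ?_
    by_cases hγ : γ = Tup.nil
    · rw [hγ, word_nil, one_mul, hS.partialIsometry]
      exact hred.1 x hx
    · rw [mul_assoc, hS.star_mul_word_of_head_ne (mt Tup.head_eq_zero.1 hγ), mul_zero]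
      exact zero_mem _
  rw [← hS.partialIsometry 0]
  exact hrange (S 0 y) (htop ▸ Submodule.mem_top)

theorem OA.map_mem_reducedBy {π : OA →⋆ₙₐ[ℂ] (H →L[ℂ] H)} (hM : IsClosed (M : Set H))
    (hs : ∀ i, π (OA.s i) ∈ reducedBy M) (a : OA) : π a ∈ reducedBy M := by
  have hcomap : NonUnitalStarSubalgebra.comap π (reducedBy M).toNonUnitalStarSubalgebra = ⊤ :=
    OA.eq_top_of_s_mem ((isClosed_reducedBy hM).preimage (map_continuous π)) hs
  exact hcomap.ge (NonUnitalStarAlgebra.mem_top (x := a))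

variable {π : OA →⋆ₙₐ[ℂ] (H →L[ℂ] H)}

theorem IsIrreducible.eq_bot_or_eq_top (hπ : IsIrreducible π) (hM : IsClosed (M : Set H))
    (hs : ∀ i, π (OA.s i) ∈ reducedBy M) : M = ⊥ ∨ M = ⊤ :=
  hπ.2 M hM fun a => (OA.map_mem_reducedBy hM hs a).1

theorem IsIrreducible.apply_s_zero_eq_zero_or_mem (hπ : IsIrreducible π)
    (hM : IsClosed (M : Set H)) (hred : π (OA.s 0) ∈ reducedBy M) :
    (∀ x ∈ M, π (OA.s 0) x = 0) ∨ ∀ x, π (OA.s 0) x ∈ M := by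
  have hS : IsWMFamily fun i => π (OA.s i) := OA.isWMFamily_s.map π
  refine (hπ.eq_bot_or_eq_top (isClosed_wordSpan _ M) (hS.mem_reducedBy_wordSpan hred)).imp
    (fun h x hx => ?_) (hS.zero_apply_mem_of_wordSpan_eq_top hM hred)
  exact (Submodule.mem_bot ℂ).1 (h ▸ word_mul_zero_mem_wordSpan _ Tup.nil hx)

theorem IsWMFamily.norm_zero_apply_zero_apply (hS : IsWMFamily S) (x : H) :
    ‖S 0 (S 0 x)‖ = ‖S 0 x‖ := by
  have hfix : (star (S 0) * S 0 * S 0) x = S 0 x :=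
    DFunLike.congr_fun (hS.star_mul_self_mul_of_le le_rfl) x
  rw [ContinuousLinearMap.apply_norm_eq_sqrt_inner_adjoint_right, norm_eq_sqrt_re_inner (𝕜 := ℂ)]
  exact congrArg (fun y => √(RCLike.re ⟪S 0 x, y⟫_ℂ)) hfix

theorem IsIrreducible.exists_isVacuum (hπ : IsIrreducible π) (h₀ : π (OA.s 0) ≠ 0) :
    ∃ z x, IsVacuum (fun i => π (OA.s i)) z x := by
  have hS : IsWMFamily fun i => π (OA.s i) := OA.isWMFamily_s.map π
  obtain ⟨z, hz⟩ := exists_mul_self_eq_smul ⟨hS.star_zero_mul_zero⟩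
    fun M => hπ.apply_s_zero_eq_zero_or_mem
  obtain ⟨y, hy⟩ : ∃ y, π (OA.s 0) y ≠ 0 := by
    by_contra! h
    exact h₀ (ContinuousLinearMap.ext h)
  have heig : π (OA.s 0) (π (OA.s 0) y) = z • π (OA.s 0) y := DFunLike.congr_fun hz y
  have hnorm : ‖z‖ = 1 := by
    have h := hS.norm_zero_apply_zero_apply y
    rw [heig, norm_smul] at h
    exact mul_right_cancel₀ (norm_ne_zero_iff.2 hy) (h.trans (one_mul _).symm)
  refine ⟨⟨z, mem_sphere_zero_iff_norm.2 hnorm⟩, (‖π (OA.s 0) y‖ : ℂ)⁻¹ • π (OA.s 0) y, ?_, ?_⟩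
  · exact norm_smul_inv_norm hy
  · rw [map_smul, heig, smul_comm]

namespace IsVacuum

variable {z : Circle} {x : H}

theorem star_zero_apply_zero_apply (hx : IsVacuum S z x) (hS : IsWMFamily S) :
    star (S 0) (S 0 x) = x := by
  have hfix : star (S 0) (S 0 (S 0 x)) = S 0 x :=
    DFunLike.congr_fun (hS.star_mul_self_mul_of_le le_rfl) x
  rw [hx.zero_apply, map_smul, map_smul] at hfix
  exact smul_right_injective H z.coe_ne_zero hfix

theorem zero_mem_reducedBy_span (hx : IsVacuum S z x) (hS : IsWMFamily S) :
    S 0 ∈ reducedBy (ℂ ∙ x) := by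
  have hstar : star (S 0) x = (z : ℂ)⁻¹ • x := by
    have h := hx.star_zero_apply_zero_apply hS
    rw [hx.zero_apply, map_smul] at h
    exact (eq_inv_smul_iff₀ z.coe_ne_zero).2 h
  refine ⟨fun v hv => ?_, fun v hv => ?_⟩ <;>
    obtain ⟨c, rfl⟩ := Submodule.mem_span_singleton.1 hv
  · rw [map_smul, hx.zero_apply]
    exact Submodule.smul_mem _ _ (Submodule.smul_mem _ _ (Submodule.mem_span_singleton_self x))
  · rw [map_smul, hstar]
    exact Submodule.smul_mem _ _ (Submodule.smul_mem _ _ (Submodule.mem_span_singleton_self x))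

theorem orthonormal (hx : IsVacuum S z x) (hS : IsWMFamily S) :
    Orthonormal ℂ fun γ => (word S γ * S 0) x := by
  classical
  rw [orthonormal_iff_ite]
  intro γ δ
  rw [← ContinuousLinearMap.adjoint_inner_right, ← ContinuousLinearMap.star_eq_adjoint]
  change ⟪x, (star (word S γ * S 0) * (word S δ * S 0)) x⟫_ℂ = _
  rw [hS.star_word_mul_word]
  split_ifs
  · change ⟪x, star (S 0) (S 0 x)⟫_ℂ = 1
    rw [hx.star_zero_apply_zero_apply hS, inner_self_eq_norm_sq_to_K, hx.norm_eq_one]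
    norm_num
  · exact inner_zero_right x

/-- The orthonormal basis of words applied to a cyclic vacuum vector. -/
def basis (hx : IsVacuum S z x) (hS : IsWMFamily S) (htop : wordSpan S (ℂ ∙ x) = ⊤) :
    HilbertBasis Tup ℂ H :=
  HilbertBasis.mk (hx.orthonormal hS) <| by
    rw [← htop]
    refine Submodule.topologicalClosure_mono (Submodule.span_le.2 ?_)
    rintro _ ⟨γ, v, hv, rfl⟩
    obtain ⟨c, rfl⟩ := Submodule.mem_span_singleton.1 hv
    rw [map_smul]
    exact Submodule.smul_mem _ _ (Submodule.subset_span ⟨γ, rfl⟩)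

section Basis

variable (hx : IsVacuum S z x) (hS : IsWMFamily S) (htop : wordSpan S (ℂ ∙ x) = ⊤)

theorem basis_apply (γ : Tup) : hx.basis hS htop γ = (word S γ * S 0) x :=
  congrFun (HilbertBasis.coe_mk _ _) γ

theorem apply_basis_of_push {i : ℕ} {γ δ : Tup} (h : Tup.push i γ = some δ) :
    S i (hx.basis hS htop γ) = hx.basis hS htop δ := by
  rw [basis_apply, basis_apply, word_of_push h, mul_assoc]
  rfl

theorem apply_basis_of_lt_head {i : ℕ} {γ : Tup} (h : i < γ.head) :
    S i (hx.basis hS htop γ) = 0 := by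
  rw [basis_apply]
  exact DFunLike.congr_fun (hS.mul_word_of_lt_head h) x

theorem zero_apply_basis_nil :
    S 0 (hx.basis hS htop Tup.nil) = (z : ℂ) • hx.basis hS htop Tup.nil := by
  rw [basis_apply, word_nil, one_mul, hx.zero_apply, map_smul, hx.zero_apply]

variable {K : Type*} [NormedAddCommGroup K] [InnerProductSpace ℂ K] [CompleteSpace K]
  {S' : ℕ → K →L[ℂ] K} {y : K}

include hx hS htop in
theorem exists_intertwining (hy : IsVacuum S' z y) (hS' : IsWMFamily S')
    (htop' : wordSpan S' (ℂ ∙ y) = ⊤) :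
    ∃ U : H ≃ₗᵢ[ℂ] K, ∀ i v, U (S i v) = S' i (U v) := by
  classical
  let b := hx.basis hS htop
  let b' := hy.basis hS' htop'
  let U : H ≃ₗᵢ[ℂ] K := b.repr.trans b'.repr.symm
  have hU : ∀ γ, U (b γ) = b' γ := fun γ => by
    change b'.repr.symm (b.repr (b γ)) = b' γ
    rw [b.repr_self, b'.repr_symm_single]
  have hgen : ∀ i γ, U (S i (b γ)) = S' i (U (b γ)) := fun i γ => by
    rw [hU]
    rcases lt_or_ge i γ.head with hi | hi
    · rw [apply_basis_of_lt_head hx hS htop hi, apply_basis_of_lt_head hy hS' htop' hi, map_zero]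
    rcases Nat.eq_zero_or_pos i with rfl | hpos
    · obtain rfl := Tup.head_eq_zero.1 (Nat.le_zero.1 hi)
      rw [zero_apply_basis_nil, zero_apply_basis_nil, map_smul, hU]
    · obtain ⟨δ, hδ⟩ := Option.isSome_iff_exists.1 (Tup.push_isSome.2 ⟨hpos, hi⟩)
      rw [apply_basis_of_push hx hS htop hδ, apply_basis_of_push hy hS' htop' hδ, hU]
  refine ⟨U, fun i v => ?_⟩
  let V : H →L[ℂ] K := U.toContinuousLinearEquiv
  have hcomp : V ∘L S i = S' i ∘L V := by
    refine ContinuousLinearMap.ext_on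
      (Submodule.dense_iff_topologicalClosure_eq_top.2 b.dense_span) ?_
    rintro _ ⟨γ, rfl⟩
    exact hgen i γ
  exact DFunLike.congr_fun hcomp v

end Basis

theorem star_zero_apply_mem_span (hx : IsVacuum S z x) (hS : IsWMFamily S)
    (htop : wordSpan S (ℂ ∙ x) = ⊤) (y : H) : star (S 0) y ∈ ℂ ∙ x := by
  have hmaps : ∀ v ∈ wordSpan S (ℂ ∙ x), star (S 0) v ∈ ℂ ∙ x := by
    refine mapsTo_wordSpan (Submodule.closed_of_finiteDimensional _) fun γ v hv => ?_
    by_cases hγ : γ = Tup.nil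
    · rw [hγ, word_nil, one_mul]
      have hred := hx.zero_mem_reducedBy_span hS
      exact hred.2 _ (hred.1 v hv)
    · rw [hS.star_mul_word_of_head_ne (mt Tup.head_eq_zero.1 hγ)]
      exact zero_mem _
  exact hmaps y (htop ▸ Submodule.mem_top)

theorem isIrreducible (hx : IsVacuum (fun i => π (OA.s i)) z x)
    (htop : wordSpan (fun i => π (OA.s i)) (ℂ ∙ x) = ⊤) : IsIrreducible π := by
  set S : ℕ → H →L[ℂ] H := fun i => π (OA.s i) with hSdef
  have hS : IsWMFamily S := OA.isWMFamily_s.map π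
  refine ⟨fun h => hx.zero_ne_zero (by rw [hSdef, h]; rfl),
    fun M hM hinv => or_iff_not_imp_left.2 fun hbot => ?_⟩
  have hred : ∀ i, S i ∈ reducedBy M :=
    fun i => ⟨hinv (OA.s i), by rw [← map_star]; exact hinv (star (OA.s i))⟩
  have hword : ∀ γ, word S γ * S 0 ∈ reducedBy M := fun γ =>
    mul_mem (list_prod_mem fun _ h => by
      obtain ⟨i, -, rfl⟩ := List.mem_map.1 h
      exact hred i) (hred 0)
  obtain ⟨f, hf, hf₀⟩ := M.ne_bot_iff.1 hbot
  obtain ⟨γ, hγ⟩ : ∃ γ, (hx.basis hS htop).repr f γ ≠ 0 := by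
    by_contra! h
    exact hf₀ ((hx.basis hS htop).repr.map_eq_zero_iff.1 (lp.ext (funext h)))
  rw [HilbertBasis.repr_apply_apply, basis_apply, ← ContinuousLinearMap.adjoint_inner_right,
    ← ContinuousLinearMap.star_eq_adjoint] at hγ
  obtain ⟨c, hc⟩ := Submodule.mem_span_singleton.1
    (hx.star_zero_apply_mem_span hS htop (star (word S γ) f))
  have hcM : c • x = star (word S γ * S 0) f := by rw [hc, star_mul]; rfl
  rw [← hcM, inner_smul_right] at hγ
  have hxM : x ∈ M :=
    (M.smul_mem_iff (left_ne_zero_of_mul hγ)).1 (hcM ▸ (hword γ).2 f hf)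
  have hle : ∀ v ∈ wordSpan S (ℂ ∙ x), (1 : H →L[ℂ] H) v ∈ M :=
    mapsTo_wordSpan hM fun δ v hv =>
      (hword δ).1 v ((Submodule.span_singleton_le_iff_mem x M).2 hxM hv)
  exact top_le_iff.1 fun v _ => hle v (htop ▸ Submodule.mem_top)

end IsVacuum

end Vacuum

section Equivalence

variable {A B : Type*} [NonUnitalCStarAlgebra A] [NonUnitalCStarAlgebra B]
  {H : Type*} [NormedAddCommGroup H] [InnerProductSpace ℂ H] [CompleteSpace H]
  {K : Type*} [NormedAddCommGroup K] [InnerProductSpace ℂ K] [CompleteSpace K]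

theorem IsIrreducible.comp_surjective {π : B →⋆ₙₐ[ℂ] (H →L[ℂ] H)} (hπ : IsIrreducible π)
    {θ : A →⋆ₙₐ[ℂ] B} (hθ : Function.Surjective θ) : IsIrreducible (π.comp θ) := by
  refine ⟨fun h => hπ.1 (NonUnitalStarAlgHom.ext fun b => ?_),
    fun M hM h => hπ.2 M hM (hθ.forall.2 h)⟩
  obtain ⟨a, rfl⟩ := hθ b
  exact DFunLike.congr_fun h a

theorem IsIrreducible.of_comp {π : B →⋆ₙₐ[ℂ] (H →L[ℂ] H)} {θ : A →⋆ₙₐ[ℂ] B}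
    (hπ : IsIrreducible (π.comp θ)) : IsIrreducible π :=
  ⟨fun h => hπ.1 (by rw [h]; rfl), fun M hM h => hπ.2 M hM fun a => h (θ a)⟩

theorem UnitarilyEquivalent.comp {π : B →⋆ₙₐ[ℂ] (H →L[ℂ] H)} {ρ : B →⋆ₙₐ[ℂ] (K →L[ℂ] K)}
    (h : UnitarilyEquivalent π ρ) (θ : A →⋆ₙₐ[ℂ] B) :
    UnitarilyEquivalent (π.comp θ) (ρ.comp θ) :=
  h.imp fun _ hU a => hU (θ a)

theorem UnitarilyEquivalent.apply_ne_zero {π : A →⋆ₙₐ[ℂ] (H →L[ℂ] H)}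
    {ρ : A →⋆ₙₐ[ℂ] (K →L[ℂ] K)} (h : UnitarilyEquivalent π ρ) {a : A} (ha : ρ a ≠ 0) :
    π a ≠ 0 := by
  obtain ⟨U, hU⟩ := h
  refine fun h₀ => ha (ContinuousLinearMap.ext fun v => ?_)
  rw [← U.apply_symm_apply v, ← hU, h₀]
  exact map_zero U

variable {π : OA →⋆ₙₐ[ℂ] (H →L[ℂ] H)} {ρ : OA →⋆ₙₐ[ℂ] (K →L[ℂ] K)}

theorem unitarilyEquivalent_of_s {U : H ≃ₗᵢ[ℂ] K}
    (hU : ∀ i v, U (π (OA.s i) v) = ρ (OA.s i) (U v)) : UnitarilyEquivalent π ρ := by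
  have hconj : (U.conjStarAlgEquiv : (H →L[ℂ] H) →⋆ₙₐ[ℂ] (K →L[ℂ] K)).comp π = ρ := by
    refine OA.hom_ext fun i => ContinuousLinearMap.ext fun v => ?_
    change U (π (OA.s i) (U.symm v)) = ρ (OA.s i) v
    rw [hU, U.apply_symm_apply]
  refine ⟨U, fun a v => ?_⟩
  rw [← hconj]
  change U (π a v) = U (π a (U.symm (U v)))
  rw [U.symm_apply_apply]

variable {z : Circle} {x : H} {y : K}

theorem IsIrreducible.wordSpan_eq_top (hπ : IsIrreducible π)
    (hx : IsVacuum (fun i => π (OA.s i)) z x) : wordSpan (fun i => π (OA.s i)) (ℂ ∙ x) = ⊤ := by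
  have hS : IsWMFamily fun i => π (OA.s i) := OA.isWMFamily_s.map π
  refine (hπ.eq_bot_or_eq_top (isClosed_wordSpan _ _)
    (hS.mem_reducedBy_wordSpan (hx.zero_mem_reducedBy_span hS))).resolve_left fun hbot => ?_
  have hzero : π (OA.s 0) x = 0 := (Submodule.mem_bot ℂ).1 <| hbot ▸
    word_mul_zero_mem_wordSpan _ Tup.nil (Submodule.mem_span_singleton_self x)
  rw [hx.zero_apply] at hzero
  exact smul_ne_zero z.coe_ne_zero hx.ne_zero hzero

theorem IsIrreducible.unitarilyEquivalent_of_isVacuum (hπ : IsIrreducible π)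
    (hρ : IsIrreducible ρ) (hx : IsVacuum (fun i => π (OA.s i)) z x)
    (hy : IsVacuum (fun i => ρ (OA.s i)) z y) : UnitarilyEquivalent π ρ := by
  obtain ⟨U, hU⟩ := hx.exists_intertwining (OA.isWMFamily_s.map π) (hπ.wordSpan_eq_top hx)
    hy (OA.isWMFamily_s.map ρ) (hρ.wordSpan_eq_top hy)
  exact unitarilyEquivalent_of_s hU

end Equivalence

namespace Fock

theorem vacuumProj_vacuum : vacuumProj vacuum = vacuum :=
  Submodule.starProjection_eq_self_iff.2 (Submodule.mem_span_singleton_self vacuum)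

theorem isVacuum_vacuum (z : Circle) : IsVacuum (family z) z vacuum where
  norm_eq_one := norm_vacuum
  zero_apply := congrArg ((z : ℂ) • ·) vacuumProj_vacuum

theorem family_e_of_push (z : Circle) {i : ℕ} {γ δ : Tup} (h : Tup.push i γ = some δ) :
    family z i (e γ) = e δ := by
  obtain ⟨i, rfl⟩ := Nat.exists_eq_add_of_le' (Tup.one_le_of_push h)
  refine (shiftOp_e _ γ).trans ?_
  change (Tup.push (i + 1) γ).elim 0 e = e δ
  rw [h]
  rfl

theorem word_family_vacuum (z : Circle) (γ : Tup) : word (family z) γ vacuum = e γ := by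
  induction γ using Tup.induction with
  | nil => rfl
  | push h ih =>
    rw [word_of_push h, ← family_e_of_push z h, ← ih]
    rfl

theorem wordSpan_family_vacuum (z : Circle) : wordSpan (family z) (ℂ ∙ vacuum) = ⊤ := by
  have he : ∀ γ, e γ ∈ wordSpan (family z) (ℂ ∙ vacuum) := fun γ => by
    have h := word_mul_zero_mem_wordSpan (family z) γ (Submodule.mem_span_singleton_self vacuum)
    have hz : (word (family z) γ * family z 0) vacuum = (z : ℂ) • e γ := by
      change word (family z) γ (family z 0 vacuum) = _
      rw [(isVacuum_vacuum z).zero_apply, map_smul, word_family_vacuum]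
    rw [hz] at h
    exact (Submodule.smul_mem_iff _ z.coe_ne_zero).1 h
  have : CompleteSpace (wordSpan (family z) (ℂ ∙ vacuum)) :=
    (isClosed_wordSpan _ _).completeSpace_coe
  rw [← Submodule.orthogonal_eq_bot_iff, eq_bot_iff]
  refine fun g hg => lp.ext (funext fun γ => ?_)
  rw [← inner_e]
  exact (Submodule.mem_orthogonal _ _).1 hg _ (he γ)

end Fock

section Classification

theorem isVacuum_piZero (z : Circle) : IsVacuum (fun i => piZero z (OA.s i)) z Fock.vacuum :=
  (funext (OA.lift_s (Fock.isWMFamily_family z))) ▸ Fock.isVacuum_vacuum z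

theorem piZero_s_zero_ne_zero (z : Circle) : piZero z (OA.s 0) ≠ 0 :=
  (isVacuum_piZero z).zero_ne_zero

theorem isIrreducible_piZero (z : Circle) : IsIrreducible (piZero z) :=
  (isVacuum_piZero z).isIrreducible <|
    (funext (OA.lift_s (Fock.isWMFamily_family z))) ▸ Fock.wordSpan_family_vacuum z

theorem isIrreducible_piTilde {n : ℕ} (Ψ : OA ≃⋆ₐ[ℂ] Q n) (z : Circle) :
    IsIrreducible (piTilde Ψ z) :=
  (isIrreducible_piZero z).comp_surjective (Ψ.symm.surjective.comp (proj_surjective n))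

variable {H : Type*} [NormedAddCommGroup H] [InnerProductSpace ℂ H] [CompleteSpace H]
  {π : OA →⋆ₙₐ[ℂ] (H →L[ℂ] H)}

theorem IsIrreducible.exists_unitarilyEquivalent_piZero (hπ : IsIrreducible π)
    (h₀ : π (OA.s 0) ≠ 0) : ∃ z, UnitarilyEquivalent π (piZero z) := by
  obtain ⟨z, x, hx⟩ := hπ.exists_isVacuum h₀
  exact ⟨z, hπ.unitarilyEquivalent_of_isVacuum (isIrreducible_piZero z) hx (isVacuum_piZero z)⟩

theorem IsIrreducible.exists_first_s_ne_zero (hπ : IsIrreducible π) :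
    ∃ n, π (OA.s n) ≠ 0 ∧ ∀ i < n, π (OA.s i) = 0 := by
  classical
  have hex : ∃ n, π (OA.s n) ≠ 0 := by
    by_contra! h
    exact hπ.1 (OA.hom_ext h)
  exact ⟨Nat.find hex, Nat.find_spec hex, fun i hi => not_not.1 (Nat.find_min hex hi)⟩

theorem IsIrreducible.exists_unitarilyEquivalent_piTilde (hπ : IsIrreducible π)
    {Ψ : (n : ℕ) → OA ≃⋆ₐ[ℂ] Q n} (hΨ : ∀ n i, Ψ n (OA.s i) = proj n (OA.s (i + n))) :
    ∃ n z, UnitarilyEquivalent π (piTilde (Ψ n) z) := by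
  obtain ⟨n, hn, hlt⟩ := hπ.exists_first_s_ne_zero
  let σ : OA →⋆ₙₐ[ℂ] (H →L[ℂ] H) := (Q.lift π hlt).comp (Ψ n : OA →⋆ₙₐ[ℂ] Q n)
  let θ : OA →⋆ₙₐ[ℂ] OA := ((Ψ n).symm : Q n →⋆ₙₐ[ℂ] OA).comp (proj n)
  have hfactor : σ.comp θ = π := NonUnitalStarAlgHom.ext fun a => by
    change Q.lift π hlt (Ψ n ((Ψ n).symm (proj n a))) = π a
    rw [StarAlgEquiv.apply_symm_apply, Q.lift_proj]
  have hσ₀ : σ (OA.s 0) ≠ 0 := by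
    change Q.lift π hlt (Ψ n (OA.s 0)) ≠ 0
    rwa [hΨ, Q.lift_proj, Nat.zero_add]
  have hσ : IsIrreducible σ := IsIrreducible.of_comp (θ := θ) (hfactor.symm ▸ hπ)
  obtain ⟨z, hz⟩ := hσ.exists_unitarilyEquivalent_piZero hσ₀
  exact ⟨n, z, hfactor ▸ hz.comp θ⟩

end Classification

end WM

end

theorem mainTheorem9 :
    (∀ n : ℕ, ∃! Ψ : WM.OA ≃⋆ₐ[ℂ] WM.Q n, ∀ i, Ψ (WM.OA.s i) = WM.proj n (WM.OA.s (i + n))) ∧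
    ∀ Ψ : (n : ℕ) → WM.OA ≃⋆ₐ[ℂ] WM.Q n,
      (∀ n i, Ψ n (WM.OA.s i) = WM.proj n (WM.OA.s (i + n))) →
      (∀ (n : ℕ) (z : Circle), WM.IsIrreducible (WM.piTilde (Ψ n) z)) ∧
      (∀ z : Circle, WM.IsIrreducible (WM.piZero z) ∧ WM.piZero z (WM.OA.s 0) ≠ 0) ∧
      ∀ (H : Type*) [NormedAddCommGroup H] [InnerProductSpace ℂ H] [CompleteSpace H]
        (π : WM.OA →⋆ₙₐ[ℂ] (H →L[ℂ] H)), WM.IsIrreducible π →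
        (∃ (n : ℕ) (z : Circle), WM.UnitarilyEquivalent π (WM.piTilde (Ψ n) z)) ∧
        (π (WM.OA.s 0) ≠ 0 ↔ ∃ z : Circle, WM.UnitarilyEquivalent π (WM.piZero z)) := by
  refine ⟨WM.existsUnique_shiftEquiv, fun Ψ hΨ => ⟨fun n z => WM.isIrreducible_piTilde (Ψ n) z,
    fun z => ⟨WM.isIrreducible_piZero z, WM.piZero_s_zero_ne_zero z⟩,
    fun H _ _ _ π hπ => ⟨hπ.exists_unitarilyEquivalent_piTilde hΨ,
      hπ.exists_unitarilyEquivalent_piZero, ?_⟩⟩⟩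
  rintro ⟨z, hz⟩
  exact hz.apply_ne_zero (WM.piZero_s_zero_ne_zero z)
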